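/- **The gasket.** For an integer $n\ge 0$ let $SG(n)$ be the $n$-th stage graph of the two-dimensional Sierpinski gasket: $SG(0)$ is a triangle, and $SG(n+1)$ consists of three copies of $SG(n)$ placed so that any two of them share one outmost vertex. Let $o$, $a_n$, $b_n$ be the leftmost, rightmost and topmost vertices of $SG(n)$, where $SG(n)$ is always the lower-left part of $SG(n+1)$, so that $o$ is common to all stages. For $k\ge 0$ let $c_k$ be the midpoint of the side $a_{k+1}b_{k+1}$ of $SG(k+1)$, so that $a_k,b_k,c_k$ are the corners of the largest empty triangle of $SG(k+1)$. **The probabilities.** For a vertex $x$ of $SG(n)$ and $j\in\{1,2,3,4\}$: * $F_j(n,x)$ is the proportion, among all spanning trees of $SG(n)$, of those in which $x$ has degree $j$; * $G_j(n,x)$ is the proportion with $x$ of degree $j$ among the spanning forests of $SG(n)$ with exactly two components, one containing $b_n$ and the other containing both $o$ and $a_n$; * $H_j(n,x)$ is the proportion with $x$ of degree $j$ among the spanning forests of $SG(n)$ with exactly three components, with $o,a_n,b_n$ in three different components. **The matrices.** For a vertex $x$ of $SG(m)$, $m\ge1$, let $\tilde x$ be its image under the reflection of $SG(m)$ that fixes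 $o$ and exchanges $a_m$ and $b_m$, and $\hat x$ its image under the reflection that fixes $a_m$ and exchanges $o$ and $b_m$. Let $B_j(m,m-1)$ be the $3\times5$ matrix whose rows, for $x=a_{m-1},\,b_{m-1},\,c_{m-1}$ in this order, are $$\bigl(F_j(m,x),\;G_j(m,x),\;G_j(m,\tilde x),\;G_j(m,\hat x),\;H_j(m,x)\bigr).$$ Let $e_1=(1,0,0,0,0)^T$ and $$L=\begin{pmatrix}\frac23&\frac35&\frac35&\frac35&\frac6{25}\\ \frac16&\frac3{10}&\frac1{10}&0&\frac7{50}\\ \frac16&\frac1{10}&\frac3{10}&\frac1{10}&\frac7{50}\\ 0&0&0&\frac3{10}&\frac6{25}\\ 0&0&0&0&\frac6{25}\end{pmatrix},\quad R=\begin{pmatrix}\frac23&\frac35&\frac1{10}&\frac35&\frac6{25}\\ \frac16&\frac3{10}&\frac1{10}&\frac1{10}&\frac7{50}\\ 0&0&\frac25&0&\frac6{25}\\ \frac16&\frac1{10}&\frac1{10}&\frac3{10}&\frac7{50}\\ 0&0&\frac3{10}&0&\frac6{25}\end{pmatrix},\quad E=\begin{pmatrix}3&0&0&0&0\\0&2&1&0&0\\0&1&1&1&0\\0&0&1&2&0\\0&0&0&0&3\end{pmatrix}.$$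 **Proposition.** Let $n\ge3$ and $j\in\{1,2,3,4\}$. Then the sum $\Phi_j(n)=\sum_{x\in V(SG(n))}F_j(n,x)$ satisfies $$\begin{aligned}\Phi_j(n)&=(1,1,1)\Bigl\{\sum_{m=1}^{n}B_j(m,m-1)R^{n-m}+2\sum_{m=1}^{n-1}B_j(m,m-1)RL^{n-m-1}\\&\qquad+2\sum_{m=1}^{n-2}B_j(m,m-1)\sum_{s=1}^{n-m-1}R(ER)^sL^{n-1-m-s}\Bigr\}e_1+3F_j(n,o)\\ &=(1,1,1)\Bigl\{\sum_{m=1}^{n}B_j(m,m-1)R^{n-m}+2B_j(n-1,n-2)R\\&\qquad+2\sum_{m=1}^{n-2}B_j(m,m-1)\Bigl[\sum_{s=0}^{n-m-1}R(ER)^sL^{n-m-1-s}\Bigr]\Bigr\}e_1+3F_j(n,o).\end{aligned}$$ -/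

import Mathlib

namespace SierpinskiGasket

/-! The Sierpinski gasket is drawn in the triangular lattice: `(p, q)` stands for the point
`p • (1, 0) + q • (1/2, √3/2)` of the plane. Stage `n` fills the triangle with corners
`o = (0, 0)`, `a_n = (2 ^ n, 0)` (rightmost) and `b_n = (0, 2 ^ n)` (topmost). -/

/-- The vertex set of `SG(n)`: a triangle for `n = 0`; stage `n + 1` is made of three copies of
stage `n`, the second and third translated by `a_n` and by `b_n`. -/
def verts : ℕ → Finset (ℕ × ℕ)
  | 0 => {(0, 0), (1, 0), (0, 1)}
  | n + 1 => verts n ∪ (verts n).image (· + (2 ^ n, 0)) ∪ (verts n).image (· + (0, 2 ^ n))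

/-- The edges of `SG(n)`, as a graph on the whole lattice. -/
def latticeGraph : ℕ → SimpleGraph (ℕ × ℕ)
  | 0 => SimpleGraph.fromEdgeSet {s((0, 0), (1, 0)), s((0, 0), (0, 1)), s((1, 0), (0, 1))}
  | n + 1 => latticeGraph n ⊔ (latticeGraph n).map (· + (2 ^ n, 0)) ⊔
      (latticeGraph n).map (· + (0, 2 ^ n))

/-- The type of vertices of `SG(n)`. -/
abbrev Vert (n : ℕ) : Type := {v : ℕ × ℕ // v ∈ verts n}

/-- The Sierpinski gasket graph `SG(n)`. -/
def SG (n : ℕ) : SimpleGraph (Vert n) := (latticeGraph n).comap Subtype.val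

theorem mem_verts_succ {n : ℕ} {v : ℕ × ℕ} : v ∈ verts (n + 1) ↔
    v ∈ verts n ∨ (∃ w ∈ verts n, w + (2 ^ n, 0) = v) ∨ (∃ w ∈ verts n, w + (0, 2 ^ n) = v) := by
  simp only [verts, Finset.mem_union, Finset.mem_image, or_assoc]

theorem o_mem (n : ℕ) : ((0, 0) : ℕ × ℕ) ∈ verts n := by
  induction n with
  | zero => decide
  | succ n ih => exact mem_verts_succ.2 (Or.inl ih)

theorem a_mem (n : ℕ) : ((2 ^ n, 0) : ℕ × ℕ) ∈ verts n := by
  induction n with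
  | zero => decide
  | succ n ih =>
    refine mem_verts_succ.2 (Or.inr (Or.inl ⟨_, ih, ?_⟩))
    ext <;> simp [pow_succ, mul_two]

theorem b_mem (n : ℕ) : ((0, 2 ^ n) : ℕ × ℕ) ∈ verts n := by
  induction n with
  | zero => decide
  | succ n ih =>
    refine mem_verts_succ.2 (Or.inr (Or.inr ⟨_, ih, ?_⟩))
    ext <;> simp [pow_succ, mul_two]

theorem c_mem (n : ℕ) : ((2 ^ n, 2 ^ n) : ℕ × ℕ) ∈ verts (n + 1) := by
  refine mem_verts_succ.2 (Or.inr (Or.inl ⟨_, b_mem n, ?_⟩))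
  ext <;> simp

theorem add_le_of_mem {n : ℕ} {v : ℕ × ℕ} (hv : v ∈ verts n) : v.1 + v.2 ≤ 2 ^ n := by
  induction n generalizing v with
  | zero =>
    simp only [verts, Finset.mem_insert, Finset.mem_singleton] at hv
    rcases hv with rfl | rfl | rfl <;> simp
  | succ n ih =>
    rw [pow_succ]
    rcases mem_verts_succ.1 hv with h | ⟨w, h, rfl⟩ | ⟨w, h, rfl⟩ <;>
      have := ih h <;> simp at * <;> omega

theorem tilde_mem {n : ℕ} {v : ℕ × ℕ} (hv : v ∈ verts n) : (v.2, v.1) ∈ verts n := by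
  induction n generalizing v with
  | zero =>
    simp only [verts, Finset.mem_insert, Finset.mem_singleton] at hv
    rcases hv with rfl | rfl | rfl <;> decide
  | succ n ih =>
    rcases mem_verts_succ.1 hv with h | ⟨w, h, rfl⟩ | ⟨w, h, rfl⟩
    · exact mem_verts_succ.2 (Or.inl (ih h))
    · exact mem_verts_succ.2 (Or.inr (Or.inr ⟨_, ih h, by ext <;> simp⟩))
    · exact mem_verts_succ.2 (Or.inr (Or.inl ⟨_, ih h, by ext <;> simp⟩))

theorem hat_mem {n : ℕ} {v : ℕ × ℕ} (hv : v ∈ verts n) :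
    (v.1, 2 ^ n - v.1 - v.2) ∈ verts n := by
  induction n generalizing v with
  | zero =>
    simp only [verts, Finset.mem_insert, Finset.mem_singleton] at hv
    rcases hv with rfl | rfl | rfl <;> decide
  | succ n ih =>
    rcases mem_verts_succ.1 hv with h | ⟨w, h, rfl⟩ | ⟨w, h, rfl⟩
    · refine mem_verts_succ.2 (Or.inr (Or.inr ⟨_, ih h, ?_⟩))
      have := add_le_of_mem h
      ext <;> simp [pow_succ] <;> omega
    · refine mem_verts_succ.2 (Or.inr (Or.inl ⟨_, ih h, ?_⟩))
      have := add_le_of_mem h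
      ext <;> simp [pow_succ] <;> omega
    · refine mem_verts_succ.2 (Or.inl ?_)
      have := add_le_of_mem h
      convert ih h using 2
      · simp
      · simp only [Prod.fst_add, Prod.snd_add, pow_succ]
        omega

/-- The leftmost vertex `o` of `SG(n)`. -/
def o (n : ℕ) : Vert n := ⟨(0, 0), o_mem n⟩

/-- The rightmost vertex `a_n` of `SG(n)`. -/
def rightmost (n : ℕ) : Vert n := ⟨(2 ^ n, 0), a_mem n⟩

/-- The topmost vertex `b_n` of `SG(n)`. -/
def topmost (n : ℕ) : Vert n := ⟨(0, 2 ^ n), b_mem n⟩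

/-- The vertices `a_k`, `b_k`, `c_k` of `SG(k + 1)`: the corners of its largest lacunary
triangle. -/
def lacunary (k : ℕ) : Fin 3 → Vert (k + 1) :=
  ![⟨(2 ^ k, 0), mem_verts_succ.2 (Or.inl (a_mem k))⟩,
    ⟨(0, 2 ^ k), mem_verts_succ.2 (Or.inl (b_mem k))⟩,
    ⟨(2 ^ k, 2 ^ k), c_mem k⟩]

/-- Reflection of `SG(n)` in its axis through `o`; it exchanges `a_n` and `b_n`. -/
def tilde {n : ℕ} (x : Vert n) : Vert n := ⟨(x.1.2, x.1.1), tilde_mem x.2⟩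

/-- Reflection of `SG(n)` in its axis through `a_n`; it exchanges `o` and `b_n`. The natural
number subtractions do not truncate, by `add_le_of_mem`. -/
def hat {n : ℕ} (x : Vert n) : Vert n := ⟨(x.1.1, 2 ^ n - x.1.1 - x.1.2), hat_mem x.2⟩

/-- The spanning trees of `SG(n)`. -/
def treeSet (n : ℕ) : Set (SimpleGraph (Vert n)) :=
  {T | T ≤ SG n ∧ T.IsTree}

/-- The spanning subgraphs of `SG(n)` that consist of two trees, one containing `b_n` and the
other containing `o` and `a_n`. -/
def twoTreeSet (n : ℕ) : Set (SimpleGraph (Vert n)) :=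
  {T | T ≤ SG n ∧ T.IsAcyclic ∧ Nat.card T.ConnectedComponent = 2 ∧
    T.Reachable (o n) (rightmost n) ∧ ¬ T.Reachable (o n) (topmost n)}

/-- The spanning subgraphs of `SG(n)` that consist of three trees, with `o`, `a_n` and `b_n` in
three different ones. -/
def threeTreeSet (n : ℕ) : Set (SimpleGraph (Vert n)) :=
  {T | T ≤ SG n ∧ T.IsAcyclic ∧ Nat.card T.ConnectedComponent = 3 ∧
    ¬ T.Reachable (o n) (rightmost n) ∧ ¬ T.Reachable (o n) (topmost n) ∧
    ¬ T.Reachable (rightmost n) (topmost n)}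

/-- The proportion of the graphs in `S` in which exactly `j` edges meet at the vertex `x`. -/
noncomputable def degProb {V : Type} (S : Set (SimpleGraph V)) (j : ℕ) (x : V) : ℚ :=
  ({T ∈ S | (T.neighborSet x).ncard = j}.ncard : ℚ) / (S.ncard : ℚ)

/-- `F_j(n, x)`. -/
noncomputable def F (j n : ℕ) (x : Vert n) : ℚ := degProb (treeSet n) j x

/-- `G_j(n, x)`. -/
noncomputable def G (j n : ℕ) (x : Vert n) : ℚ := degProb (twoTreeSet n) j x

/-- `H_j(n, x)`. -/
noncomputable def H (j n : ℕ) (x : Vert n) : ℚ := degProb (threeTreeSet n) j x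

/-- `Φ_j(n)`, the sum of `F_j(n, x)` over all vertices `x` of `SG(n)`. -/
noncomputable def Phi (j n : ℕ) : ℚ := ∑ x : Vert n, F j n x

/-- The `3 × 5` matrix `B_j(k + 1, k)`; its rows belong to `a_k`, `b_k`, `c_k`. -/
noncomputable def B (j k : ℕ) : Matrix (Fin 3) (Fin 5) ℚ :=
  Matrix.of fun i =>
    let x := lacunary k i
    ![F j (k + 1) x, G j (k + 1) x, G j (k + 1) (tilde x), G j (k + 1) (hat x), H j (k + 1) x]

/-- The matrix `L`. -/
def matL : Matrix (Fin 5) (Fin 5) ℚ :=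
  !![2/3, 3/5,  3/5,  3/5,  6/25;
     1/6, 3/10, 1/10, 0,    7/50;
     1/6, 1/10, 3/10, 1/10, 7/50;
     0,   0,    0,    3/10, 6/25;
     0,   0,    0,    0,    6/25]

/-- The matrix `R`. -/
def matR : Matrix (Fin 5) (Fin 5) ℚ :=
  !![2/3, 3/5,  1/10, 3/5,  6/25;
     1/6, 3/10, 1/10, 1/10, 7/50;
     0,   0,    2/5,  0,    6/25;
     1/6, 1/10, 1/10, 3/10, 7/50;
     0,   0,    3/10, 0,    6/25]

/-- The matrix `E`. -/
def matE : Matrix (Fin 5) (Fin 5) ℚ :=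
  !![3, 0, 0, 0, 0;
     0, 2, 1, 0, 0;
     0, 1, 1, 1, 0;
     0, 0, 1, 2, 0;
     0, 0, 0, 0, 3]

/-- The column vector `e₁ = (1, 0, 0, 0, 0)ᵀ`. -/
def e1 : Fin 5 → ℚ := ![1, 0, 0, 0, 0]

/-- The number `(1, 1, 1) M e₁`. -/
def sandwich (M : Matrix (Fin 3) (Fin 5) ℚ) : ℚ :=
  dotProduct ![1, 1, 1] (M.mulVec e1)

end SierpinskiGasket

open SierpinskiGasket

namespace SierpinskiGasket

open Function

/-! Classify the spanning forests in question by the partition of the three corners that their trees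
induce: five types. A forest of `SG (n + 1)` restricts to a forest of some type on each copy of `SG
n`, and which triples of types fit together is a finite question, `Compat`. Edge counts add under
gluing, so the forests of a given type correspond to compatible triples of forests
(`glue_mem_forests_iff`).

The number of forests of type `q` has the form `weight q * A * ρ ^ blocks q`
(`ncard_patternForests`), and all compositions of a forest of type `r` use the same total number of
blocks. Hence `A` and `ρ` cancel from every proportion: the law of the type of one piece, given the
type of the whole, does not depend on `n`. A vertex that is not a corner keeps its degree, so
placing `SG n` as the copy `i` multiplies its row of five probabilities by the fixed matrix
`transfer i` (`probRow_copy`). For the right copy this matrix is `matR`; the other two are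
conjugates of it by reflections.

Summed over non-corner vertices, the rows obey a linear recursion: multiply by the sum `stepMat` of
the three matrices, then add the contribution of the new empty triangle (`sum_interior_succ`). It
remains to evaluate `w * stepMat ^ k * e₁` for `w = (1, 1, 1) B_j(m, m - 1)`. The reflections
permute the corners of the empty triangle, so `w` is symmetric in its three middle entries, and they
fix `e₁`. Words in the three matrices are sorted by their last run of equal letters, and symmetry
reduces them to two kinds (`entry_stepMat_pow`). On symmetric rows `stepMat` acts as `matR * matE`
(`vecMul_stepMat_pow`), and on `e₁` the powers of the lower-left matrix agree with those of `matL`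
(`lowerLeft_pow_mulVec`). -/

/-! ### Forests rooted at three terminals -/

/-- The partitions of the three terminals, numbered so that `0` has one block, `1`, `2` and `3`
single out the terminals `2`, `1` and `0`, and `4` has three blocks: `joined r i j` says that
`i` and `j` are in the same block of the partition `r`. -/
def joined (r : Fin 5) (i j : Fin 3) : Bool :=
  i = j || r = 0 || (r = 1 && i ≠ 2 && j ≠ 2) || (r = 2 && i ≠ 1 && j ≠ 1) ||
    (r = 3 && i ≠ 0 && j ≠ 0)

/-- The number of blocks of a partition of the terminals. -/
def blocks : Fin 5 → ℕ := ![1, 2, 2, 2, 3]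

/-- The subgraph `T` connects the terminals `t` according to the partition `r`, and every vertex
to some terminal. -/
def HasPattern {V : Type} (t : Fin 3 → V) (r : Fin 5) (T : SimpleGraph V) : Prop :=
  (∀ v, ∃ k, T.Reachable v (t k)) ∧ ∀ i j, T.Reachable (t i) (t j) ↔ joined r i j

/-- The spanning forests of `G` with one tree for each block of the partition `r` of the
terminals. -/
def forests {V : Type} (G : SimpleGraph V) (t : Fin 3 → V) (r : Fin 5) : Set (SimpleGraph V) :=
  {T | T ≤ G ∧ HasPattern t r T ∧ Nat.card T.edgeSet + blocks r = Nat.card V}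

theorem reachable_induction {V : Type} {T : SimpleGraph V} {P : V → Prop}
    (h : ∀ u v, T.Adj u v → P u → P v) {u v : V} (huv : T.Reachable u v) (hu : P u) : P v := by
  obtain ⟨p⟩ := huv
  induction p with
  | nil => exact hu
  | cons hadj _ ih => exact ih (h _ _ hadj hu)

theorem card_edgeSet_sup_edge {V : Type} [Finite V] {T : SimpleGraph V} {u v : V}
    (h : ¬ T.Reachable u v) :
    Nat.card (T ⊔ SimpleGraph.edge u v).edgeSet = Nat.card T.edgeSet + 1 := by
  have hne : u ≠ v := fun e => h (e ▸ SimpleGraph.Reachable.refl _)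
  rw [SimpleGraph.edgeSet_sup, SimpleGraph.edgeSet_edge_of_ne hne, Nat.card_coe_set_eq,
    Set.union_singleton, Set.ncard_insert_of_notMem, Nat.card_coe_set_eq]
  intro hmem
  exact h (SimpleGraph.Adj.reachable hmem)

theorem reachable_sup_edge {V : Type} {T : SimpleGraph V} (u v : V) :
    (T ⊔ SimpleGraph.edge u v).Reachable u v := by
  by_cases h : u = v
  · rw [h]
  · exact SimpleGraph.Adj.reachable (by simp [SimpleGraph.edge_adj, h])

/-- Three points have exactly five partitions; all Boolean relations on them are checked. -/
theorem exists_joined_eq (r : Fin 3 → Fin 3 → Bool) (h1 : ∀ i, r i i)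
    (h2 : ∀ i j, r i j → r j i) (h3 : ∀ i j k, r i j → r j k → r i k) :
    ∃ q, ∀ i j, r i j = joined q i j := by
  revert r
  decide +kernel

theorem exists_pattern {V : Type} {t : Fin 3 → V} {T : SimpleGraph V}
    (h : ∀ v, ∃ k, T.Reachable v (t k)) : ∃ r, HasPattern t r T := by
  classical
  obtain ⟨q, hq⟩ := exists_joined_eq (fun i j => decide (T.Reachable (t i) (t j)))
    (by simp) (by simpa using fun i j h => h.symm)
    (by simpa using fun i j k h h' => h.trans h')
  exact ⟨q, h, fun i j => by rw [← hq]; simp⟩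

theorem HasPattern.unique {V : Type} {t : Fin 3 → V} {T : SimpleGraph V} {r s : Fin 5}
    (hr : HasPattern t r T) (hs : HasPattern t s T) : r = s := by
  have h : ∀ i j, joined r i j = joined s i j := fun i j => by
    rw [Bool.eq_iff_iff, ← hr.2, ← hs.2]
  have : ∀ r s : Fin 5, (∀ i j, joined r i j = joined s i j) → r = s := by decide +kernel
  exact this _ _ h

/-! ### Edge counts and acyclicity -/

section Count

variable {V : Type} [Finite V] {t : Fin 3 → V} {T : SimpleGraph V}

theorem edge_count_of_one_block (h : HasPattern t 0 T) :
    Nat.card V ≤ Nat.card T.edgeSet + 1 ∧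
      (T.IsAcyclic ↔ Nat.card T.edgeSet + 1 = Nat.card V) := by
  have hconn : T.Connected := by
    have : Nonempty V := ⟨t 0⟩
    refine ⟨fun u v => ?_⟩
    obtain ⟨k, hk⟩ := h.1 u
    obtain ⟨l, hl⟩ := h.1 v
    exact hk.trans (((h.2 k l).2 (by simp [joined])).trans hl.symm)
  refine ⟨hconn.card_vert_le_card_edgeSet_add_one, ?_⟩
  have := T.isTree_iff_connected_and_card
  rw [SimpleGraph.isTree_iff] at this
  tauto

/-- An edge between two components merges them, creates no cycle and raises the edge count by one.
This reduces the edge count for two or three blocks to the connected case. -/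
theorem edge_count_step {u v : V} {k : ℕ} (huv : ¬ T.Reachable u v)
    (h : Nat.card V ≤ Nat.card (T ⊔ SimpleGraph.edge u v).edgeSet + k ∧
      ((T ⊔ SimpleGraph.edge u v).IsAcyclic ↔
        Nat.card (T ⊔ SimpleGraph.edge u v).edgeSet + k = Nat.card V)) :
    Nat.card V ≤ Nat.card T.edgeSet + (k + 1) ∧
      (T.IsAcyclic ↔ Nat.card T.edgeSet + (k + 1) = Nat.card V) := by
  rw [card_edgeSet_sup_edge huv, T.isAcyclic_add_edge_iff_of_not_reachable u v huv] at h
  rw [add_comm k 1, ← add_assoc]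
  exact h

theorem edge_count_of_two_blocks {r : Fin 5} (hr : blocks r = 2) (h : HasPattern t r T) :
    Nat.card V ≤ Nat.card T.edgeSet + 2 ∧
      (T.IsAcyclic ↔ Nat.card T.edgeSet + 2 = Nat.card V) := by
  obtain ⟨i, j, hij, hall⟩ : ∃ i j, joined r i j = false ∧
      ∀ k, joined r k i ∨ joined r k j := by
    clear h
    revert r
    decide +kernel
  refine edge_count_step (u := t i) (v := t j) (by simp [h.2, hij])
    (edge_count_of_one_block (t := t) ?_)
  have hle : T ≤ T ⊔ SimpleGraph.edge (t i) (t j) := le_sup_left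
  have key : ∀ k, (T ⊔ SimpleGraph.edge (t i) (t j)).Reachable (t k) (t i) := fun k => by
    rcases hall k with hk | hk
    · exact ((h.2 _ _).2 hk).mono hle
    · exact (((h.2 _ _).2 hk).mono hle).trans (reachable_sup_edge _ _).symm
  refine ⟨fun v => ?_, fun k l => ?_⟩
  · obtain ⟨k, hk⟩ := h.1 v
    exact ⟨k, hk.mono hle⟩
  · simpa [joined] using (key k).trans (key l).symm

theorem edge_count_of_three_blocks (h : HasPattern t 4 T) :
    Nat.card V ≤ Nat.card T.edgeSet + 3 ∧
      (T.IsAcyclic ↔ Nat.card T.edgeSet + 3 = Nat.card V) := by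
  have hn : ∀ i j, i ≠ j → ¬ T.Reachable (t i) (t j) := fun i j hij => by
    simp [h.2, joined, hij]
  refine edge_count_step (hn 0 1 (by decide)) (edge_count_of_two_blocks (t := t) (r := 1) rfl ?_)
  have hle : T ≤ T ⊔ SimpleGraph.edge (t 0) (t 1) := le_sup_left
  -- The component of terminal `2` contains neither end of the new edge, so it does not grow.
  have key : ∀ v, (T ⊔ SimpleGraph.edge (t 0) (t 1)).Reachable (t 2) v → T.Reachable (t 2) v := by
    intro v hv
    refine reachable_induction (P := fun w => T.Reachable (t 2) w) ?_ hv (by rfl)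
    intro u w huw hu
    simp only [SimpleGraph.sup_adj, SimpleGraph.edge_adj] at huw
    rcases huw with huw | ⟨⟨rfl, rfl⟩ | ⟨rfl, rfl⟩, -⟩
    · exact hu.trans huw.reachable
    · exact absurd hu (hn _ _ (by decide))
    · exact absurd hu (hn _ _ (by decide))
  have h01 : (T ⊔ SimpleGraph.edge (t 0) (t 1)).Reachable (t 0) (t 1) := reachable_sup_edge _ _
  have h20 : ¬ (T ⊔ SimpleGraph.edge (t 0) (t 1)).Reachable (t 2) (t 0) :=
    fun h' => hn _ _ (by decide) (key _ h')
  have h21 : ¬ (T ⊔ SimpleGraph.edge (t 0) (t 1)).Reachable (t 2) (t 1) :=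
    fun h' => hn _ _ (by decide) (key _ h')
  refine ⟨fun v => ?_, fun k l => ?_⟩
  · obtain ⟨k, hk⟩ := h.1 v
    exact ⟨k, hk.mono hle⟩
  · fin_cases k <;> fin_cases l <;>
      simp [joined, h01, h01.symm, h20, h21, SimpleGraph.reachable_comm (v := t 2)]

theorem HasPattern.edge_count {r : Fin 5} (h : HasPattern t r T) :
    Nat.card V ≤ Nat.card T.edgeSet + blocks r ∧
      (T.IsAcyclic ↔ Nat.card T.edgeSet + blocks r = Nat.card V) := by
  fin_cases r
  · exact edge_count_of_one_block h
  · exact edge_count_of_two_blocks rfl h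
  · exact edge_count_of_two_blocks rfl h
  · exact edge_count_of_two_blocks rfl h
  · exact edge_count_of_three_blocks h

/-- A subgraph that connects the terminals according to `r` connects every vertex to a terminal
if and only if it has as many components as `r` has blocks. -/
theorem forall_reachable_iff_card {r : Fin 5}
    (h : ∀ i j, T.Reachable (t i) (t j) ↔ joined r i j) :
    (∀ v, ∃ k, T.Reachable v (t k)) ↔ Nat.card T.ConnectedComponent = blocks r := by
  classical
  set f : Fin 3 → T.ConnectedComponent := fun k => T.connectedComponentMk (t k) with hf
  have hrange : (Set.range f).ncard = blocks r := by
    obtain ⟨s, hs1, hs2, hs3⟩ : ∃ s : Finset (Fin 3), s.card = blocks r ∧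
        (∀ i ∈ s, ∀ j ∈ s, joined r i j → i = j) ∧ ∀ i, ∃ j ∈ s, joined r i j := by
      clear h hf f
      revert r
      decide +kernel
    have : Set.range f = f '' s := by
      ext c
      constructor
      · rintro ⟨i, rfl⟩
        obtain ⟨j, hj, hij⟩ := hs3 i
        exact ⟨j, hj, SimpleGraph.ConnectedComponent.eq.2 ((h _ _).2 hij).symm⟩
      · rintro ⟨i, -, rfl⟩
        exact ⟨i, rfl⟩
    rw [this, Set.InjOn.ncard_image, Set.ncard_coe_finset, hs1]
    intro i hi j hj hij
    exact hs2 i hi j hj ((h _ _).1 (SimpleGraph.ConnectedComponent.eq.1 hij))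
  rw [← hrange, ← Set.ncard_univ]
  constructor
  · intro hall
    congr 1
    symm
    refine Set.eq_univ_of_forall fun c => ?_
    induction c using SimpleGraph.ConnectedComponent.ind with
    | h v =>
      obtain ⟨k, hk⟩ := hall v
      exact ⟨k, SimpleGraph.ConnectedComponent.eq.2 hk.symm⟩
  · intro hc v
    have huniv : Set.range f = Set.univ :=
      Set.eq_of_subset_of_ncard_le (Set.subset_univ _) hc.le
    obtain ⟨k, hk⟩ : T.connectedComponentMk v ∈ Set.range f := huniv ▸ Set.mem_univ _
    exact ⟨k, (SimpleGraph.ConnectedComponent.eq.1 hk).symm⟩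

/-- The edge count in `forests` is the form that adds up under gluing; acyclicity with a component
count is the form used by `treeSet`, `twoTreeSet` and `threeTreeSet`. -/
theorem mem_forests_iff {G : SimpleGraph V} {r : Fin 5} :
    T ∈ forests G t r ↔ T ≤ G ∧ T.IsAcyclic ∧ Nat.card T.ConnectedComponent = blocks r ∧
      ∀ i j, T.Reachable (t i) (t j) ↔ joined r i j := by
  constructor
  · rintro ⟨h1, h2, h3⟩
    exact ⟨h1, h2.edge_count.2.2 h3, (forall_reachable_iff_card h2.2).1 h2.1, h2.2⟩
  · rintro ⟨h1, h2, h3, h4⟩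
    have h5 : HasPattern t r T := ⟨(forall_reachable_iff_card h4).2 h3, h4⟩
    exact ⟨h1, h5, h5.edge_count.2.1 h2⟩

end Count

/-! ### Gluing three copies of a graph -/

/-- `W` is made of the three copies `φ i` of `V`, two of which, `φ i` and `φ j`, share exactly one
vertex, the terminal `j` of the copy `i`. -/
structure IsGluing {V W : Type} (φ : Fin 3 → V → W) (t : Fin 3 → V) : Prop where
  injective : ∀ i, Injective (φ i)
  terminal_injective : Injective t
  exists_eq : ∀ w, ∃ i u, φ i u = w
  swap : ∀ i j, φ i (t j) = φ j (t i)
  eq_terminal : ∀ {i j u v}, i ≠ j → φ i u = φ j v → u = t j ∧ v = t i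

/-- The union of the graphs `T i`, each drawn in its own copy. -/
def glue {V W : Type} (φ : Fin 3 → V → W) (T : Fin 3 → SimpleGraph V) : SimpleGraph W :=
  ⨆ i, (T i).map (φ i)

/-- The terminal `(i, i)` of the glued graph is joined to the terminal `j` of the copy `p`,
where `s i` is the partition of the terminals of the copy `i`. -/
def linked (s : Fin 3 → Fin 5) (i p j : Fin 3) : Bool :=
  -- For distinct indices `-i - j` is the third one, since `0 + 1 + 2 = 0` in `Fin 3`. The copies
  -- form a ring, and each case lists the two ways round it.
  if p = i then
    joined (s i) i j ||
      (joined (s i) i (-i - j) && joined (s (-i - j)) i j && joined (s j) (-i - j) i)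
  else if j = i then
    joined (s i) i p ||
      (joined (s i) i (-i - p) && joined (s (-i - p)) i p && joined (s p) (-i - p) i)
  else if p = j then
    (joined (s i) i j && joined (s j) i j) ||
      (joined (s i) i (-i - j) && joined (s (-i - j)) i j && joined (s j) (-i - j) j)
  else
    (joined (s i) i p && joined (s p) i j) || (joined (s i) i j && joined (s j) i p)

/-- The pieces with terminals partitioned by `s` fit together to a forest with terminals
partitioned by `r`. -/
def Compat (s : Fin 3 → Fin 5) (r : Fin 5) : Prop :=
  ((∀ i j, linked s i j j = joined r i j) ∧ ∀ p j, ∃ i, linked s i p j) ∧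
    blocks (s 0) + blocks (s 1) + blocks (s 2) = blocks r + 3

instance (s : Fin 3 → Fin 5) (r : Fin 5) : Decidable (Compat s r) := by
  unfold Compat; infer_instance

theorem linked_self (s : Fin 3 → Fin 5) (i : Fin 3) : linked s i i i := by
  simp [linked, joined]

theorem forall_fin_three_fun {α : Type} {P : (Fin 3 → α) → Prop} (h : ∀ a b c, P ![a, b, c])
    (s : Fin 3 → α) : P s := by
  have : s = ![s 0, s 1, s 2] := by ext i; fin_cases i <;> rfl
  rw [this]
  exact h _ _ _

theorem linked_swap : ∀ (s : Fin 3 → Fin 5) (i p j : Fin 3), linked s i p j = linked s i j p :=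
  forall_fin_three_fun (by decide +kernel)

theorem linked_trans : ∀ (s : Fin 3 → Fin 5) (i p j k : Fin 3),
    linked s i p j → joined (s p) j k → linked s i p k :=
  forall_fin_three_fun (by decide +kernel)

/-- The pieces are glued at three vertices, and each identification merges at most two components
into one. -/
theorem blocks_le : ∀ (s : Fin 3 → Fin 5) (r : Fin 5),
    ((∀ i j, linked s i j j = joined r i j) ∧ ∀ p j, ∃ i, linked s i p j) →
    blocks (s 0) + blocks (s 1) + blocks (s 2) ≤ blocks r + 3 :=
  forall_fin_three_fun (by decide +kernel)

namespace IsGluing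

variable {V W : Type} {φ : Fin 3 → V → W} {t : Fin 3 → V}

theorem glue_adj (h : IsGluing φ t) {T : Fin 3 → SimpleGraph V} {w w' : W} :
    (glue φ T).Adj w w' ↔ ∃ i u u', (T i).Adj u u' ∧ φ i u = w ∧ φ i u' = w' := by
  simp only [glue, SimpleGraph.iSup_adj]
  exact exists_congr fun i => SimpleGraph.map_adj ⟨φ i, h.injective i⟩ (T i) w w'

theorem adj_copy_iff (h : IsGluing φ t) {T : Fin 3 → SimpleGraph V} {i : Fin 3} {u u' : V} :
    (glue φ T).Adj (φ i u) (φ i u') ↔ (T i).Adj u u' := by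
  rw [h.glue_adj]
  constructor
  · rintro ⟨j, v, v', hadj, hu, hu'⟩
    obtain rfl | hij := eq_or_ne j i
    · rwa [← h.injective _ hu, ← h.injective _ hu']
    · exact absurd ((h.eq_terminal hij hu).1.trans (h.eq_terminal hij hu').1.symm) hadj.ne
  · exact fun hadj => ⟨i, u, u', hadj, rfl, rfl⟩

theorem comap_glue (h : IsGluing φ t) (T : Fin 3 → SimpleGraph V) (i : Fin 3) :
    (glue φ T).comap (φ i) = T i := by
  ext u u'
  exact h.adj_copy_iff

theorem glue_comap (h : IsGluing φ t) {G : SimpleGraph V} {T : SimpleGraph W}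
    (hT : T ≤ glue φ fun _ => G) : (glue φ fun i => T.comap (φ i)) = T := by
  ext w w'
  rw [h.glue_adj]
  constructor
  · rintro ⟨i, u, u', hadj, rfl, rfl⟩
    exact hadj
  · intro hadj
    obtain ⟨i, u, u', -, rfl, rfl⟩ := h.glue_adj.1 (hT hadj)
    exact ⟨i, u, u', hadj, rfl, rfl⟩

theorem glue_le_iff (h : IsGluing φ t) {G : SimpleGraph V} {T : Fin 3 → SimpleGraph V} :
    glue φ T ≤ glue φ (fun _ => G) ↔ ∀ i, T i ≤ G := by
  constructor
  · intro hle i u u' hadj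
    exact h.adj_copy_iff.1 (hle (h.adj_copy_iff.2 hadj))
  · exact fun hle => iSup_mono fun i => SimpleGraph.map_monotone _ (hle i)

theorem reachable_copy (h : IsGluing φ t) {T : Fin 3 → SimpleGraph V} {i : Fin 3} {u v : V}
    (huv : (T i).Reachable u v) : (glue φ T).Reachable (φ i u) (φ i v) :=
  reachable_induction (P := fun w => (glue φ T).Reachable (φ i u) (φ i w))
    (fun _ _ hadj hu => hu.trans (h.adj_copy_iff.2 hadj).reachable) huv (by rfl)

theorem reachable_of_linked (h : IsGluing φ t) {T : Fin 3 → SimpleGraph V} {s : Fin 3 → Fin 5}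
    (hs : ∀ i, HasPattern t (s i) (T i)) {i p j : Fin 3} (hl : linked s i p j) :
    (glue φ T).Reachable (φ i (t i)) (φ p (t j)) := by
  have step : ∀ {x : W} {p j k}, (glue φ T).Reachable x (φ p (t j)) → joined (s p) j k →
      (glue φ T).Reachable x (φ p (t k)) := fun hx hj =>
    hx.trans (h.reachable_copy (((hs _).2 _ _).2 hj))
  have hop : ∀ {x : W} {p j}, (glue φ T).Reachable x (φ p (t j)) →
      (glue φ T).Reachable x (φ j (t p)) := fun {x p j} hx => h.swap p j ▸ hx
  have start : (glue φ T).Reachable (φ i (t i)) (φ i (t i)) := .refl _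
  unfold linked at hl
  split_ifs at hl with h1 h2 h3 <;> simp only [Bool.or_eq_true, Bool.and_eq_true] at hl
  · subst h1
    rcases hl with a | ⟨⟨a, b⟩, c⟩
    · exact step start a
    · exact hop (step (hop (step (hop (step start a)) b)) c)
  · subst h2
    rcases hl with a | ⟨⟨a, b⟩, c⟩
    · exact hop (step start a)
    · exact step (hop (step (hop (step start a)) b)) c
  · subst h3
    rcases hl with ⟨a, b⟩ | ⟨⟨a, b⟩, c⟩
    · exact step (hop (step start a)) b
    · exact step (hop (step (hop (step start a)) b)) c
  · rcases hl with ⟨a, b⟩ | ⟨a, b⟩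
    · exact step (hop (step start a)) b
    · exact hop (step (hop (step start a)) b)

theorem linked_of_reachable (h : IsGluing φ t) {T : Fin 3 → SimpleGraph V} {s : Fin 3 → Fin 5}
    (hs : ∀ i, HasPattern t (s i) (T i)) {i p j : Fin 3}
    (hr : (glue φ T).Reachable (φ i (t i)) (φ p (t j))) : linked s i p j := by
  have back : ∀ {p j k}, (T p).Reachable (t j) (t k) → linked s i p k → linked s i p j :=
    fun hjk hk => linked_trans s i _ _ _ hk (((hs _).2 _ _).1 hjk.symm)
  -- Invariant along a path: inside some copy that contains it, the current vertex reaches a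
  -- terminal linked to the start.
  have key := reachable_induction
    (P := fun w => ∃ p u k, φ p u = w ∧ (T p).Reachable u (t k) ∧ linked s i p k) ?_ hr
    ⟨i, t i, i, rfl, .refl _, linked_self s i⟩
  · obtain ⟨q, u, k, hu, hk, hl⟩ := key
    obtain rfl | hqp := eq_or_ne q p
    · rw [h.injective _ hu] at hk
      exact back hk hl
    · obtain ⟨rfl, hj⟩ := h.eq_terminal hqp hu
      rw [h.terminal_injective hj, linked_swap]
      exact back hk hl
  · rintro w w' hadj ⟨q, u, k, rfl, hk, hl⟩
    obtain ⟨q', v, v', hvv', hv, rfl⟩ := h.glue_adj.1 hadj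
    obtain rfl | hqp := eq_or_ne q q'
    · rw [h.injective _ hv] at hvv'
      exact ⟨q, v', k, rfl, hvv'.symm.reachable.trans hk, hl⟩
    · obtain ⟨rfl, rfl⟩ := h.eq_terminal hqp hv.symm
      refine ⟨q', v', q, rfl, hvv'.symm.reachable, ?_⟩
      rw [linked_swap]
      exact back hk hl

/-- A copy can be left only through a terminal. A component of a piece without terminals would stay
a component of the glued graph and miss the outer terminals, or else contain one of its own. -/
theorem forall_reachable_of_glue (h : IsGluing φ t) {T : Fin 3 → SimpleGraph V}
    (hr : ∀ w, ∃ k, (glue φ T).Reachable w (φ k (t k))) (i : Fin 3) (u : V) :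
    ∃ k, (T i).Reachable u (t k) := by
  by_contra! hcon
  obtain ⟨k, hk⟩ := hr (φ i u)
  have closed : ∀ w w', (glue φ T).Adj w w' → (∃ v, φ i v = w ∧ (T i).Reachable u v) →
      ∃ v, φ i v = w' ∧ (T i).Reachable u v := by
    rintro w w' hadj ⟨v, rfl, huv⟩
    obtain ⟨j, x, x', hxx', hx, rfl⟩ := h.glue_adj.1 hadj
    obtain rfl | hij := eq_or_ne i j
    · rw [h.injective _ hx] at hxx'
      exact ⟨x', rfl, huv.trans hxx'.reachable⟩
    · exact absurd ((h.eq_terminal hij hx.symm).1 ▸ huv) (hcon j)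
  obtain ⟨v, hv, huv⟩ := reachable_induction closed hk ⟨u, rfl, .refl _⟩
  obtain rfl | hik := eq_or_ne i k
  · exact hcon i (h.injective _ hv ▸ huv)
  · exact hcon k ((h.eq_terminal hik hv).1 ▸ huv)

theorem hasPattern_glue_iff (h : IsGluing φ t) {T : Fin 3 → SimpleGraph V} {s : Fin 3 → Fin 5}
    (hs : ∀ i, HasPattern t (s i) (T i)) {r : Fin 5} :
    HasPattern (fun k => φ k (t k)) r (glue φ T) ↔
      (∀ i j, linked s i j j = joined r i j) ∧ ∀ p j, ∃ i, linked s i p j := by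
  have hlr : ∀ {i p j}, (glue φ T).Reachable (φ i (t i)) (φ p (t j)) ↔ linked s i p j :=
    ⟨h.linked_of_reachable hs, h.reachable_of_linked hs⟩
  constructor
  · rintro ⟨h1, h2⟩
    refine ⟨fun i j => ?_, fun p j => ?_⟩
    · rw [Bool.eq_iff_iff, ← h2, hlr]
    · obtain ⟨i, hi⟩ := h1 (φ p (t j))
      exact ⟨i, hlr.1 hi.symm⟩
  · rintro ⟨h1, h2⟩
    refine ⟨fun w => ?_, fun i j => ?_⟩
    · obtain ⟨p, u, rfl⟩ := h.exists_eq w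
      obtain ⟨j, hj⟩ := (hs p).1 u
      obtain ⟨i, hi⟩ := h2 p j
      exact ⟨i, (h.reachable_copy hj).trans (hlr.2 hi).symm⟩
    · rw [← h1, hlr]

theorem card_edgeSet_glue [Finite V] (h : IsGluing φ t) (T : Fin 3 → SimpleGraph V) :
    Nat.card (glue φ T).edgeSet = ∑ i, Nat.card (T i).edgeSet := by
  rw [← Nat.card_sigma]
  refine (Nat.card_congr (Equiv.ofBijective
    (fun e : Σ i, (T i).edgeSet => (⟨Sym2.map (φ e.1) e.2.1, ?_⟩ : (glue φ T).edgeSet))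
    ⟨?_, ?_⟩)).symm
  · obtain ⟨i, e, he⟩ := e
    induction e using Sym2.ind with
    | _ u v => exact h.adj_copy_iff.2 he
  · rintro ⟨i, e, he⟩ ⟨j, e', he'⟩ heq
    simp only [Subtype.mk.injEq] at heq
    obtain rfl | hij := eq_or_ne i j
    · have := Sym2.map.injective (h.injective i) heq
      subst this
      rfl
    · induction e using Sym2.ind with
      | _ u v =>
      induction e' using Sym2.ind with
      | _ u' v' =>
      simp only [Sym2.map_mk, Sym2.eq_iff] at heq
      have hne : u ≠ v := SimpleGraph.Adj.ne (G := T i) he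
      exfalso
      apply hne
      rcases heq with ⟨a, b⟩ | ⟨a, b⟩ <;>
        exact (h.eq_terminal hij a).1.trans (h.eq_terminal hij b).1.symm
  · rintro ⟨e, he⟩
    induction e using Sym2.ind with
    | _ w w' =>
      obtain ⟨i, u, u', hadj, rfl, rfl⟩ := h.glue_adj.1 he
      exact ⟨⟨i, s(u, u'), hadj⟩, rfl⟩

/-- A sum over the glued vertex set, split into the vertices inside the copies, the shared
vertices and the new terminals. -/
theorem sum_eq [Fintype V] [Fintype W] [DecidableEq V] (h : IsGluing φ t) {M : Type}
    [AddCommMonoid M] (f : W → M) :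
    ∑ w, f w = ∑ i, ∑ u ∈ Finset.univ.filter (fun u => ∀ k, u ≠ t k), f (φ i u)
      + (f (φ 0 (t 1)) + f (φ 0 (t 2)) + f (φ 1 (t 2))) + ∑ k, f (φ k (t k)) := by
  classical
  have hne : ∀ {i j k l}, φ i (t j) = φ k (t l) → (i = k ∧ j = l) ∨ (i = l ∧ j = k) := by
    intro i j k l hh
    by_cases hik : i = k
    · subst hik
      exact Or.inl ⟨rfl, h.terminal_injective (h.injective _ hh)⟩
    · obtain ⟨h1, h2⟩ := h.eq_terminal hik hh
      exact Or.inr ⟨(h.terminal_injective h2).symm, h.terminal_injective h1⟩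
  set A := (Finset.univ : Finset (Fin 3)) ×ˢ
    (Finset.univ.filter (fun u => ∀ k, u ≠ t k)) with hA
  set P : Finset (Fin 3 × Fin 3) := {(0, 1), (0, 2), (1, 2), (0, 0), (1, 1), (2, 2)} with hP
  have hAinj : Set.InjOn (fun x : Fin 3 × V => φ x.1 x.2) A := by
    rintro ⟨i, u⟩ hu ⟨j, v⟩ - huv
    simp only [hA, Finset.coe_product, Set.mem_prod, Finset.mem_coe, Finset.mem_filter,
      Finset.mem_univ, true_and] at hu
    obtain rfl | hij := eq_or_ne i j
    · exact Prod.ext rfl (h.injective _ huv)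
    · exact absurd (h.eq_terminal hij huv).1 (hu _)
  have hPinj : Set.InjOn (fun x : Fin 3 × Fin 3 => φ x.1 (t x.2)) P := by
    rintro ⟨i, j⟩ hx ⟨k, l⟩ hy hxy
    have := hne hxy
    have key : ∀ x ∈ P, ∀ y ∈ P, (x.1 = y.1 ∧ x.2 = y.2) ∨ (x.1 = y.2 ∧ x.2 = y.1) → x = y := by
      rw [hP]
      decide
    exact key _ hx _ hy this
  have hdisj : Disjoint (A.image fun x => φ x.1 x.2) (P.image fun x => φ x.1 (t x.2)) := by
    rw [Finset.disjoint_left]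
    intro w hw hw'
    obtain ⟨⟨i, u⟩, hu, rfl⟩ := Finset.mem_image.1 hw
    obtain ⟨⟨j, k⟩, -, hv⟩ := Finset.mem_image.1 hw'
    simp only [hA, Finset.mem_product, Finset.mem_filter, Finset.mem_univ, true_and] at hu hv
    obtain rfl | hij := eq_or_ne i j
    · exact hu k (h.injective _ hv.symm)
    · exact hu j (h.eq_terminal hij hv.symm).1
  have huniv : (Finset.univ : Finset W) =
      (A.image fun x => φ x.1 x.2) ∪ (P.image fun x => φ x.1 (t x.2)) := by
    symm
    refine Finset.eq_univ_of_forall fun w => ?_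
    obtain ⟨i, u, rfl⟩ := h.exists_eq w
    rw [Finset.mem_union]
    by_cases hu : ∀ k, u ≠ t k
    · exact Or.inl (Finset.mem_image.2 ⟨(i, u), by simp [hA, hu], rfl⟩)
    · push Not at hu
      obtain ⟨k, rfl⟩ := hu
      right
      have key : ∀ i k, (i, k) ∈ P ∨ (k, i) ∈ P := by
        rw [hP]
        decide
      rcases key i k with hk | hk
      · exact Finset.mem_image.2 ⟨_, hk, rfl⟩
      · exact Finset.mem_image.2 ⟨_, hk, h.swap _ _⟩
  rw [huniv, Finset.sum_union hdisj, Finset.sum_image hAinj, Finset.sum_image hPinj, hA,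
    Finset.sum_product, add_assoc]
  congr 1
  rw [hP]
  simp [add_assoc, Fin.sum_univ_three]

theorem card_eq [Finite V] [Finite W] (h : IsGluing φ t) : Nat.card W + 3 = 3 * Nat.card V := by
  classical
  have := Fintype.ofFinite V
  have := Fintype.ofFinite W
  have hW := h.sum_eq (fun _ => 1)
  have hV : (Finset.univ.filter fun u => ∀ k, u ≠ t k).card + 3 = Fintype.card V := by
    have hc : (Finset.univ.filter fun u => ∀ k, u ≠ t k) = (Finset.univ.image t)ᶜ := by
      ext u
      simp [eq_comm]
    rw [hc, ← Finset.card_compl_add_card (Finset.univ.image t),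
      Finset.card_image_of_injective _ h.terminal_injective]
    simp
  simp only [Finset.sum_const, Finset.card_univ, Fintype.card_fin, smul_eq_mul, mul_one] at hW
  rw [Nat.card_eq_fintype_card, Nat.card_eq_fintype_card]
  omega

/-- A piece has at least as many edges as a forest of its type, so the total edge count gives
`blocks r + 3` as a lower bound for the total number of blocks. `blocks_le` is the opposite bound.
Equality then makes every piece tight, that is, a forest. -/
theorem glue_mem_forests_iff [Finite V] [Finite W] (h : IsGluing φ t) {G : SimpleGraph V}
    {T : Fin 3 → SimpleGraph V} {r : Fin 5} :
    glue φ T ∈ forests (glue φ fun _ => G) (fun k => φ k (t k)) r ↔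
      ∃ s, Compat s r ∧ ∀ i, T i ∈ forests G t (s i) := by
  have hcard := h.card_eq
  have hE := h.card_edgeSet_glue T
  rw [Fin.sum_univ_three] at hE
  constructor
  · rintro ⟨hle, hpat, hc⟩
    choose s hs using fun i => exists_pattern (h.forall_reachable_of_glue hpat.1 i)
    have hl := (h.hasPattern_glue_iff hs).1 hpat
    have hb := blocks_le s r hl
    have h0 := (hs 0).edge_count.1
    have h1 := (hs 1).edge_count.1
    have h2 := (hs 2).edge_count.1
    refine ⟨s, ⟨hl, by omega⟩, fun i => ⟨h.glue_le_iff.1 hle i, hs i, ?_⟩⟩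
    fin_cases i <;> simp only [Fin.zero_eta, Fin.mk_one, Fin.reduceFinMk] <;> omega
  · rintro ⟨s, ⟨hl, hb⟩, hs⟩
    refine ⟨h.glue_le_iff.2 fun i => (hs i).1,
      (h.hasPattern_glue_iff fun i => (hs i).2.1).2 hl, ?_⟩
    have h0 := (hs 0).2.2
    have h1 := (hs 1).2.2
    have h2 := (hs 2).2.2
    omega

open Classical in
/-- Forests of a glued graph are counted by the forests of its pieces. -/
theorem ncard_forests_glue [Finite V] [Finite W] (h : IsGluing φ t) (G : SimpleGraph V)
    (P : Fin 3 → SimpleGraph V → Prop) (r : Fin 5) :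
    {T ∈ forests (glue φ fun _ => G) (fun k => φ k (t k)) r |
        ∀ i, P i (T.comap (φ i))}.ncard =
      ∑ s : Fin 3 → Fin 5, if Compat s r then
        ∏ i, {T ∈ forests G t (s i) | P i T}.ncard else 0 := by
  have e : {T ∈ forests (glue φ fun _ => G) (fun k => φ k (t k)) r |
        ∀ i, P i (T.comap (φ i))} ≃
      Σ s : {s : Fin 3 → Fin 5 // Compat s r}, ∀ i, {T ∈ forests G t (s.1 i) | P i T} := by
    symm
    refine Equiv.ofBijective (fun x => ⟨glue φ fun i => (x.2 i).1,
      h.glue_mem_forests_iff.2 ⟨x.1.1, x.1.2, fun i => (x.2 i).2.1⟩, fun i => ?_⟩) ⟨?_, ?_⟩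
    · rw [h.comap_glue]
      exact (x.2 i).2.2
    · rintro ⟨⟨s, hs⟩, T⟩ ⟨⟨s', hs'⟩, T'⟩ heq
      simp only [Subtype.mk.injEq] at heq
      have hT : ∀ i, (T i).1 = (T' i).1 := fun i => by
        have := congrArg (SimpleGraph.comap (φ i)) heq
        rwa [h.comap_glue, h.comap_glue] at this
      have hss : s = s' := by
        ext1 i
        exact HasPattern.unique (T i).2.1.2.1 (hT i ▸ (T' i).2.1.2.1)
      subst hss
      congr 1
      ext1 i
      exact Subtype.ext (hT i)
    · rintro ⟨T, hT, hP⟩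
      have hg := h.glue_comap hT.1
      obtain ⟨s, hs, hTs⟩ := h.glue_mem_forests_iff.1 (hg.symm ▸ hT)
      exact ⟨⟨⟨s, hs⟩, fun i => ⟨_, hTs i, hP i⟩⟩, Subtype.ext hg⟩
  rw [← Nat.card_coe_set_eq, Nat.card_congr e, Nat.card_sigma, ← Finset.sum_filter]
  simp only [Nat.card_pi, Nat.card_coe_set_eq]
  symm
  exact Finset.sum_subtype (Finset.univ.filter fun s => Compat s r) (by simp)
    fun s : Fin 3 → Fin 5 => ∏ i, {T ∈ forests G t (s i) | P i T}.ncard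

theorem neighborSet_glue (h : IsGluing φ t) {T : Fin 3 → SimpleGraph V} {i : Fin 3} {u : V}
    (hu : ∀ k, u ≠ t k) :
    (glue φ T).neighborSet (φ i u) = φ i '' (T i).neighborSet u := by
  ext w
  rw [SimpleGraph.mem_neighborSet, h.glue_adj]
  constructor
  · rintro ⟨j, v, v', hadj, hv, rfl⟩
    obtain rfl | hij := eq_or_ne i j
    · exact ⟨v', h.injective _ hv ▸ hadj, rfl⟩
    · exact absurd (h.eq_terminal hij hv.symm).1 (hu j)
  · rintro ⟨v, hv, rfl⟩
    exact ⟨i, u, v, hv, rfl, rfl⟩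

end IsGluing

/-! ### The gasket as a glued graph -/

/-- The outmost vertices `o`, `a_n`, `b_n` of `SG(n)`. -/
def corner (n : ℕ) : Fin 3 → Vert n := ![o n, rightmost n, topmost n]

/-- The translations that carry `SG(n)` to its three copies in `SG(n + 1)`. -/
def offset (n : ℕ) : Fin 3 → ℕ × ℕ := ![0, (2 ^ n, 0), (0, 2 ^ n)]

theorem add_offset_mem {n : ℕ} (i : Fin 3) {v : ℕ × ℕ} (hv : v ∈ verts n) :
    v + offset n i ∈ verts (n + 1) := by
  rw [mem_verts_succ]
  fin_cases i
  · exact Or.inl (by simpa [offset] using hv)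
  · exact Or.inr (Or.inl ⟨v, hv, rfl⟩)
  · exact Or.inr (Or.inr ⟨v, hv, rfl⟩)

/-- The three copies of `SG(n)` in `SG(n + 1)`. -/
def copy (n : ℕ) (i : Fin 3) (x : Vert n) : Vert (n + 1) :=
  ⟨x.1 + offset n i, add_offset_mem i x.2⟩

theorem vert_ext_iff {n : ℕ} {x y : Vert n} : x = y ↔ x.1.1 = y.1.1 ∧ x.1.2 = y.1.2 := by
  rw [Subtype.ext_iff, Prod.ext_iff]

theorem corner_injective (n : ℕ) : Injective (corner n) := by
  intro i j h
  fin_cases i <;> fin_cases j <;>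
    simp [corner, o, rightmost, topmost] at h ⊢ <;> exact pow_ne_zero n two_ne_zero h.symm

theorem isGluing_copy (n : ℕ) : IsGluing (copy n) (corner n) where
  injective i x y h := by
    rw [vert_ext_iff] at h ⊢
    simpa [copy] using h
  terminal_injective := corner_injective n
  exists_eq w := by
    rcases mem_verts_succ.1 w.2 with h | ⟨v, h, hv⟩ | ⟨v, h, hv⟩
    · exact ⟨0, ⟨w.1, h⟩, Subtype.ext (by simp [copy, offset])⟩
    · exact ⟨1, ⟨v, h⟩, Subtype.ext hv⟩
    · exact ⟨2, ⟨v, h⟩, Subtype.ext hv⟩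
  swap i j := by
    fin_cases i <;> fin_cases j <;>
      simp [copy, corner, o, rightmost, topmost, offset]
  eq_terminal := by
    intro i j u v hij h
    -- Each copy lies in its own translated triangle, and two of these triangles meet only at one
    -- corner.
    have hu := add_le_of_mem u.2
    have hv := add_le_of_mem v.2
    rw [vert_ext_iff] at h
    rw [vert_ext_iff, vert_ext_iff]
    fin_cases i <;> fin_cases j <;>
      simp [copy, corner, o, rightmost, topmost, offset] at h hij ⊢ <;> omega

theorem corner_succ (n : ℕ) : corner (n + 1) = fun k => copy n k (corner n k) := by
  ext1 k
  fin_cases k <;>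
    simp [copy, corner, o, rightmost, topmost, offset, pow_succ, mul_two]

theorem lacunary_eq (n : ℕ) : lacunary n 0 = copy n 0 (corner n 1) ∧
    lacunary n 1 = copy n 0 (corner n 2) ∧ lacunary n 2 = copy n 1 (corner n 2) := by
  refine ⟨?_, ?_, ?_⟩ <;>
    simp [copy, corner, rightmost, topmost, offset, lacunary]

theorem map_add_adj (n : ℕ) (c : ℕ × ℕ) {u v : ℕ × ℕ} :
    ((latticeGraph n).map (· + c)).Adj u v ↔
      ∃ u' v', (latticeGraph n).Adj u' v' ∧ u' + c = u ∧ v' + c = v :=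
  SimpleGraph.map_adj (addRightEmbedding c) _ _ _

theorem latticeGraph_succ_adj {n : ℕ} {u v : ℕ × ℕ} : (latticeGraph (n + 1)).Adj u v ↔
    ∃ i u' v', (latticeGraph n).Adj u' v' ∧ u' + offset n i = u ∧ v' + offset n i = v := by
  have h0 : (latticeGraph n).Adj u v ↔
      ∃ u' v', (latticeGraph n).Adj u' v' ∧ u' + offset n 0 = u ∧ v' + offset n 0 = v := by
    refine ⟨fun h => ⟨u, v, h, add_zero _, add_zero _⟩, ?_⟩
    rintro ⟨u, v, h, rfl, rfl⟩
    exact h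
  rw [latticeGraph, SimpleGraph.sup_adj, SimpleGraph.sup_adj, map_add_adj, map_add_adj, h0,
    or_assoc, Fin.exists_fin_succ, Fin.exists_fin_two]
  rfl

theorem mem_verts_of_adj {n : ℕ} {u v : ℕ × ℕ} (h : (latticeGraph n).Adj u v) : u ∈ verts n := by
  induction n generalizing u v with
  | zero =>
    simp only [latticeGraph, SimpleGraph.fromEdgeSet_adj, Set.mem_insert_iff,
      Set.mem_singleton_iff, Sym2.eq_iff] at h
    rcases h with ⟨(⟨rfl, rfl⟩ | ⟨rfl, rfl⟩) | (⟨rfl, rfl⟩ | ⟨rfl, rfl⟩) | ⟨rfl, rfl⟩ |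
      ⟨rfl, rfl⟩, -⟩ <;> decide
  | succ n ih =>
    obtain ⟨i, u', v', hadj, rfl, rfl⟩ := latticeGraph_succ_adj.1 h
    exact add_offset_mem i (ih hadj)

theorem SG_succ (n : ℕ) : SG (n + 1) = glue (copy n) fun _ => SG n := by
  ext x y
  rw [(isGluing_copy n).glue_adj]
  constructor
  · intro h
    obtain ⟨i, u', v', hadj, hu, hv⟩ := latticeGraph_succ_adj.1 h
    exact ⟨i, ⟨u', mem_verts_of_adj hadj⟩, ⟨v', mem_verts_of_adj hadj.symm⟩, hadj,
      Subtype.ext hu, Subtype.ext hv⟩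
  · rintro ⟨i, u, v, hadj, rfl, rfl⟩
    exact latticeGraph_succ_adj.2 ⟨i, u.1, v.1, hadj, rfl, rfl⟩

theorem SG_zero : SG 0 = ⊤ := by
  ext ⟨x, hx⟩ ⟨y, hy⟩
  simp only [verts, Finset.mem_insert, Finset.mem_singleton] at hx hy
  rcases hx with rfl | rfl | rfl <;> rcases hy with rfl | rfl | rfl <;>
    simp [SG, latticeGraph]

theorem corner_zero_surjective : Surjective (corner 0) := by
  rintro ⟨x, hx⟩
  simp only [verts, Finset.mem_insert, Finset.mem_singleton] at hx
  rcases hx with rfl | rfl | rfl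
  · exact ⟨0, rfl⟩
  · exact ⟨1, rfl⟩
  · exact ⟨2, rfl⟩

/-- The forests of `SG(n)` whose trees cut the corners into the blocks of `r`. -/
def patternForests (n : ℕ) (r : Fin 5) : Set (SimpleGraph (Vert n)) := forests (SG n) (corner n) r

theorem reachable_iff_joined_iff {V : Type} {t : Fin 3 → V} {T : SimpleGraph V} (r : Fin 5) :
    (∀ i j, T.Reachable (t i) (t j) ↔ joined r i j) ↔
      (T.Reachable (t 0) (t 1) ↔ joined r 0 1) ∧ (T.Reachable (t 0) (t 2) ↔ joined r 0 2) ∧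
        (T.Reachable (t 1) (t 2) ↔ joined r 1 2) := by
  refine ⟨fun h => ⟨h _ _, h _ _, h _ _⟩, fun ⟨h1, h2, h3⟩ i j => ?_⟩
  have hs : ∀ i j, joined r i j = joined r j i := by clear * -; revert r; decide +kernel
  have hr : ∀ i, joined r i i := by clear * -; revert r; decide +kernel
  have hs' : ∀ i j, T.Reachable (t i) (t j) ↔ T.Reachable (t j) (t i) :=
    fun _ _ => SimpleGraph.reachable_comm
  fin_cases i <;> fin_cases j <;>
    simp only [Fin.zero_eta, Fin.mk_one, Fin.reduceFinMk, hr, h1, h2, h3, hs' 1 0, hs' 2 0, hs' 2 1,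
      hs 1 0, hs 2 0, hs 2 1, SimpleGraph.Reachable.refl]

theorem treeSet_eq (n : ℕ) : treeSet n = patternForests n 0 := by
  ext T
  rw [patternForests, mem_forests_iff, treeSet, Set.mem_ofPred_eq, SimpleGraph.isTree_iff]
  refine and_congr_right fun _ => ?_
  constructor
  · rintro ⟨h1, h2⟩
    have hr : ∀ i j, T.Reachable (corner n i) (corner n j) ↔ joined 0 i j := fun i j => by
      simpa [joined] using h1.preconnected _ _
    exact ⟨h2, (forall_reachable_iff_card hr).1 fun v => ⟨0, h1.preconnected _ _⟩, hr⟩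
  · rintro ⟨h2, hc, hr⟩
    have : Nonempty (Vert n) := ⟨o n⟩
    refine ⟨⟨fun u v => ?_⟩, h2⟩
    obtain ⟨k, hk⟩ := (forall_reachable_iff_card hr).2 hc u
    obtain ⟨l, hl⟩ := (forall_reachable_iff_card hr).2 hc v
    exact hk.trans (((hr k l).2 (by simp [joined])).trans hl.symm)

theorem twoTreeSet_eq (n : ℕ) : twoTreeSet n = patternForests n 1 := by
  ext T
  rw [patternForests, mem_forests_iff, reachable_iff_joined_iff, twoTreeSet, Set.mem_ofPred_eq]
  have h1 : joined 1 0 1 = true := rfl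
  have h2 : joined 1 0 2 = false := rfl
  have h3 : joined 1 1 2 = false := rfl
  simp only [h1, h2, h3, blocks, corner, Matrix.cons_val_zero, Matrix.cons_val_one,
    Matrix.cons_val, iff_true, Bool.false_eq_true, iff_false]
  have : T.Reachable (o n) (rightmost n) → ¬ T.Reachable (o n) (topmost n) →
      ¬ T.Reachable (rightmost n) (topmost n) := fun a b c => b (a.trans c)
  tauto

theorem threeTreeSet_eq (n : ℕ) : threeTreeSet n = patternForests n 4 := by
  ext T
  rw [patternForests, mem_forests_iff, reachable_iff_joined_iff, threeTreeSet, Set.mem_ofPred_eq]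
  have h1 : joined 4 0 1 = false := rfl
  have h2 : joined 4 0 2 = false := rfl
  have h3 : joined 4 1 2 = false := rfl
  simp [h1, h2, h3, blocks, corner]

/-! ### The forests of a triangle -/

/-- The graph on the three terminals in which the edge opposite to the terminal `k` is present
if `b k` is true. -/
def triangleGraph {V : Type} (t : Fin 3 → V) (ht : Injective t) (b : Fin 3 → Bool) :
    SimpleGraph V where
  Adj x y := ∃ i j, t i = x ∧ t j = y ∧ i ≠ j ∧ b (-i - j)
  symm := ⟨by
    rintro x y ⟨i, j, rfl, rfl, hij, hb⟩
    exact ⟨j, i, rfl, rfl, hij.symm, by rwa [neg_sub_left, add_comm, ← neg_sub_left]⟩⟩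
  loopless := ⟨by
    rintro x ⟨i, j, rfl, h, hij, -⟩
    exact hij (ht h).symm⟩

section Triangle

variable {V : Type} {t : Fin 3 → V}

theorem triangleGraph_adj (ht : Bijective t) {b : Fin 3 → Bool} {i j : Fin 3} :
    (triangleGraph t ht.1 b).Adj (t i) (t j) ↔ i ≠ j ∧ b (-i - j) := by
  constructor
  · rintro ⟨i', j', hi, hj, h⟩
    rwa [← ht.1 hi, ← ht.1 hj]
  · exact fun h => ⟨i, j, rfl, rfl, h⟩

theorem triangleGraph_bijective (ht : Bijective t) : Bijective (triangleGraph t ht.1) := by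
  classical
  constructor
  · intro b b' h
    ext1 k
    have h1 : ∀ b : Fin 3 → Bool, (triangleGraph t ht.1 b).Adj (t (k + 1)) (t (k + 2)) ↔ b k := by
      intro b
      rw [triangleGraph_adj ht]
      have : k + 1 ≠ k + 2 ∧ -(k + 1) - (k + 2) = k := by revert k; decide
      rw [this.2]
      simp [this.1]
    rw [Bool.eq_iff_iff, ← h1, ← h1, h]
  · intro T
    refine ⟨fun k => decide (T.Adj (t (k + 1)) (t (k + 2))), ?_⟩
    ext x y
    obtain ⟨i, rfl⟩ := ht.2 x
    obtain ⟨j, rfl⟩ := ht.2 y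
    rw [triangleGraph_adj ht]
    have hk : i ≠ j → (-i - j + 1 = i ∧ -i - j + 2 = j) ∨ (-i - j + 1 = j ∧ -i - j + 2 = i) := by
      revert i j
      decide
    rw [decide_eq_true_eq]
    constructor
    · rintro ⟨hij, hadj⟩
      rcases hk hij with ⟨h1, h2⟩ | ⟨h1, h2⟩ <;> rw [h1, h2] at hadj
      · exact hadj
      · exact hadj.symm
    · intro hadj
      have hij : i ≠ j := fun h => hadj.ne (congrArg t h)
      refine ⟨hij, ?_⟩
      rcases hk hij with ⟨h1, h2⟩ | ⟨h1, h2⟩ <;> rw [h1, h2]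
      · exact hadj
      · exact hadj.symm

/-- The only routes between distinct vertices are the direct edge and the path through the third
vertex, whose edges lie opposite to `j` and to `i`. -/
theorem triangleGraph_reachable (ht : Bijective t) {b : Fin 3 → Bool} {i j : Fin 3} :
    (triangleGraph t ht.1 b).Reachable (t i) (t j) ↔ i = j ∨ b (-i - j) ∨ (b i ∧ b j) := by
  constructor
  · intro h
    have := reachable_induction
      (P := fun x => ∃ j, t j = x ∧ (i = j ∨ b (-i - j) ∨ (b i ∧ b j))) ?_ h ⟨i, rfl, Or.inl rfl⟩
    · obtain ⟨k, hk, h⟩ := this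
      rwa [← ht.1 hk]
    · rintro x y ⟨k, l, rfl, rfl, hkl⟩ ⟨k', hk', hik⟩
      rw [ht.1 hk'] at hik
      refine ⟨l, rfl, ?_⟩
      clear h hk'
      revert b i k l
      decide +kernel
  · by_cases hij : i = j
    · intro
      rw [hij]
    · rintro (h | h | ⟨h1, h2⟩)
      · exact absurd h hij
      · exact ((triangleGraph_adj ht).2 ⟨hij, h⟩).reachable
      · have hk : i ≠ -i - j ∧ -i - (-i - j) = j ∧ -i - j ≠ j ∧ -(-i - j) - j = i := by
          clear h1 h2
          revert i j
          decide
        exact ((triangleGraph_adj ht).2 ⟨hk.1, by rwa [hk.2.1]⟩).reachable.trans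
          ((triangleGraph_adj ht).2 ⟨hk.2.2.1, by rwa [hk.2.2.2]⟩).reachable

theorem card_edgeSet_triangleGraph (ht : Bijective t) (b : Fin 3 → Bool) :
    Nat.card (triangleGraph t ht.1 b).edgeSet = (Finset.univ.filter fun k => b k = true).card := by
  rw [← Fintype.card_subtype, ← Nat.card_eq_fintype_card]
  have hk : ∀ k : Fin 3, k + 1 ≠ k + 2 ∧ -(k + 1) - (k + 2) = k := by decide
  symm
  refine Nat.card_congr (Equiv.ofBijective (fun k => ⟨s(t (k.1 + 1), t (k.1 + 2)), ?_⟩) ⟨?_, ?_⟩)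
  · rw [SimpleGraph.mem_edgeSet, triangleGraph_adj ht, (hk _).2]
    exact ⟨(hk _).1, k.2⟩
  · rintro ⟨k, hbk⟩ ⟨l, hbl⟩ h
    simp only [Subtype.mk.injEq, Sym2.eq_iff, ht.1.eq_iff] at h ⊢
    clear hk hbk hbl
    revert k l
    decide
  · rintro ⟨e, he⟩
    induction e using Sym2.ind with
    | _ x y =>
    obtain ⟨i, rfl⟩ := ht.2 x
    obtain ⟨j, rfl⟩ := ht.2 y
    obtain ⟨hij, hb⟩ := (triangleGraph_adj ht).1 he
    refine ⟨⟨-i - j, hb⟩, ?_⟩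
    simp only [Subtype.mk.injEq, Sym2.eq_iff, ht.1.eq_iff]
    clear hb he hk
    revert i j
    decide

theorem ncard_forests_triangle (ht : Bijective t) (r : Fin 5) :
    (forests (⊤ : SimpleGraph V) t r).ncard = ![3, 1, 1, 1, 1] r := by
  have hV : Nat.card V = 3 := by
    rw [← Nat.card_congr (Equiv.ofBijective t ht)]
    simp
  have himg : forests (⊤ : SimpleGraph V) t r = triangleGraph t ht.1 ''
      ↑(Finset.univ.filter fun b : Fin 3 → Bool =>
        (∀ i j, (i = j ∨ b (-i - j) ∨ (b i ∧ b j)) ↔ joined r i j) ∧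
          (Finset.univ.filter fun k => b k = true).card + blocks r = 3) := by
    ext T
    obtain ⟨b, rfl⟩ := (triangleGraph_bijective ht).2 T
    rw [(triangleGraph_bijective ht).1.mem_set_image]
    simp only [forests, HasPattern, Set.mem_ofPred_eq, le_top, true_and, hV,
      card_edgeSet_triangleGraph ht, triangleGraph_reachable ht, Finset.coe_filter,
      Finset.mem_univ]
    rw [and_congr_left_iff]
    intro _
    refine and_iff_right fun v => ?_
    obtain ⟨k, rfl⟩ := ht.2 v
    exact ⟨k, .refl _⟩
  rw [himg, Set.ncard_image_of_injective _ (triangleGraph_bijective ht).1, Set.ncard_coe_finset]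
  clear himg
  revert r
  decide +kernel

end Triangle

theorem ncard_patternForests_zero (r : Fin 5) :
    (patternForests 0 r).ncard = ![3, 1, 1, 1, 1] r := by
  rw [patternForests, SG_zero]
  exact ncard_forests_triangle ⟨corner_injective 0, corner_zero_surjective⟩ r

/-! ### Reflections -/

/-- An automorphism that permutes the terminals by `π` permutes the forest types accordingly. -/
theorem comap_mem_forests_iff {V : Type} [Finite V] {G T : SimpleGraph V} {t : Fin 3 → V}
    (e : V ≃ V) (hG : G.comap e = G) {π : Fin 3 → Fin 3} (hπ : ∀ i, e (t i) = t (π i))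
    (hs : Surjective π) {r r' : Fin 5} (hb : blocks r = blocks r')
    (hr : ∀ i j, joined r i j = joined r' (π i) (π j)) :
    T.comap e ∈ forests G t r ↔ T ∈ forests G t r' := by
  have hle : T.comap e ≤ G ↔ T ≤ G := by
    constructor
    · intro h x y hxy
      obtain ⟨x, rfl⟩ := e.surjective x
      obtain ⟨y, rfl⟩ := e.surjective y
      have := h hxy
      rwa [← hG] at this
    · intro h x y hxy
      rw [← hG]
      exact h hxy
  let f : T.comap e ≃g T := SimpleGraph.Iso.comap e T
  have hreach : ∀ x y, (T.comap e).Reachable x y ↔ T.Reachable (e x) (e y) :=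
    fun x y => (SimpleGraph.Iso.reachable_iff (φ := f)).symm
  have hedge : Nat.card (T.comap e).edgeSet = Nat.card T.edgeSet := Nat.card_congr f.mapEdgeSet
  simp only [forests, HasPattern, Set.mem_ofPred_eq, hle, hreach, hπ, hedge, hb, hr]
  refine and_congr_right fun _ => and_congr_left fun _ => and_congr ?_ ?_
  · rw [e.surjective.forall (p := fun v => ∃ k, T.Reachable v (t k))]
    exact forall_congr' fun v => (hs.exists (p := fun k => T.Reachable (e v) (t k))).symm
  · rw [hs.forall (p := fun i => ∀ j, T.Reachable (t i) (t j) ↔ joined r' i j)]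
    exact forall_congr' fun i =>
      (hs.forall (p := fun j => T.Reachable (t (π i)) (t j) ↔ joined r' (π i) j)).symm

theorem degProb_comap {V : Type} [Finite V] {G : SimpleGraph V} {t : Fin 3 → V}
    (e : V ≃ V) (hG : G.comap e = G) {π : Fin 3 → Fin 3} (hπ : ∀ i, e (t i) = t (π i))
    (hs : Surjective π) {r r' : Fin 5} (hb : blocks r = blocks r')
    (hr : ∀ i j, joined r i j = joined r' (π i) (π j)) (j : ℕ) (x : V) :
    degProb (forests G t r) j x = degProb (forests G t r') j (e x) := by
  have hinj : Injective (SimpleGraph.comap (V := V) e) := fun T T' h => by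
    ext x y
    obtain ⟨x, rfl⟩ := e.surjective x
    obtain ⟨y, rfl⟩ := e.surjective y
    change (T.comap e).Adj x y ↔ (T'.comap e).Adj x y
    rw [h]
  have hsurj : ∀ T : SimpleGraph V, (T.comap e.symm).comap e = T := fun T => by
    ext x y
    simp
  have himg : ∀ P : SimpleGraph V → Prop, {T ∈ forests G t r | P T} =
      SimpleGraph.comap e '' {T ∈ forests G t r' | P (T.comap e)} := by
    intro P
    ext T
    rw [← hsurj T, hinj.mem_set_image]
    exact and_congr_left fun _ => comap_mem_forests_iff e hG hπ hs hb hr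
  have h1 := himg fun _ => True
  simp only [and_true, Set.ofPred_mem_eq] at h1
  rw [degProb, degProb, himg, h1, Set.ncard_image_of_injective _ hinj,
    Set.ncard_image_of_injective _ hinj]
  congr 4
  ext T
  refine and_congr_right fun _ => ?_
  have : (T.comap e).neighborSet x = e ⁻¹' T.neighborSet (e x) := rfl
  rw [this, Set.ncard_preimage_of_injective_subset_range e.injective (by simp)]

/-- Induction on the stage: an involution that permutes the copies and acts on each as the previous
involution preserves adjacency. -/
theorem comap_SG_of_copy (ρ : ∀ n, Vert n → Vert n) (hρ : ∀ n, Involutive (ρ n))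
    {π : Fin 3 → Fin 3} (h : ∀ n i x, ρ (n + 1) (copy n i x) = copy n (π i) (ρ n x)) (n : ℕ) :
    (SG n).comap (ρ n) = SG n := by
  have key : ∀ x y, (SG n).Adj x y → (SG n).Adj (ρ n x) (ρ n y) := by
    induction n with
    | zero =>
      intro x y
      rw [SG_zero]
      exact (hρ 0).injective.ne
    | succ n ih =>
      intro x y hxy
      rw [SG_succ] at hxy ⊢
      obtain ⟨i, u, v, huv, rfl, rfl⟩ := (isGluing_copy n).glue_adj.1 hxy
      rw [h, h, (isGluing_copy n).adj_copy_iff]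
      exact ih _ _ huv
  ext x y
  refine ⟨fun hxy => ?_, key x y⟩
  have := key _ _ hxy
  rwa [hρ n, hρ n] at this

theorem tilde_involutive (n : ℕ) : Involutive (tilde (n := n)) := fun _ => rfl

theorem hat_involutive (n : ℕ) : Involutive (hat (n := n)) := by
  intro x
  have := add_le_of_mem x.2
  rw [vert_ext_iff]
  simp only [hat, true_and]
  omega

theorem tilde_copy (n : ℕ) (i : Fin 3) (x : Vert n) :
    tilde (copy n i x) = copy n (![0, 2, 1] i) (tilde x) := by
  rw [vert_ext_iff]
  fin_cases i <;> simp [tilde, copy, offset]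

theorem hat_copy (n : ℕ) (i : Fin 3) (x : Vert n) :
    hat (copy n i x) = copy n (![2, 1, 0] i) (hat x) := by
  have := add_le_of_mem x.2
  rw [vert_ext_iff]
  fin_cases i <;> simp [hat, copy, offset, pow_succ] <;> omega

theorem tilde_corner (n : ℕ) (i : Fin 3) : tilde (corner n i) = corner n (![0, 2, 1] i) := by
  fin_cases i <;> rfl

theorem hat_corner (n : ℕ) (i : Fin 3) : hat (corner n i) = corner n (![2, 1, 0] i) := by
  rw [vert_ext_iff]
  fin_cases i <;> simp [hat, corner, o, rightmost, topmost]

/-- Exchanging `a_n` and `b_n` exchanges the types `1` and `2`, which single out `b_n` and `a_n`. -/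
theorem degProb_tilde (n j : ℕ) (r : Fin 5) (x : Vert n) :
    degProb (patternForests n r) j (tilde x) =
      degProb (patternForests n (![0, 2, 1, 3, 4] r)) j x := by
  symm
  refine degProb_comap (tilde_involutive n).toPerm
    (comap_SG_of_copy (fun n => tilde (n := n)) tilde_involutive tilde_copy n)
    (tilde_corner n) (by decide) ?_ ?_ j x
  · revert r
    decide
  · revert r
    decide +kernel

theorem degProb_hat (n j : ℕ) (r : Fin 5) (x : Vert n) :
    degProb (patternForests n r) j (hat x) =
      degProb (patternForests n (![0, 3, 2, 1, 4] r)) j x := by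
  symm
  refine degProb_comap (hat_involutive n).toPerm
    (comap_SG_of_copy (fun n => hat (n := n)) hat_involutive hat_copy n)
    (hat_corner n) (by decide) ?_ ?_ j x
  · revert r
    decide
  · revert r
    decide +kernel

/-! ### Counting forests -/

/-- The number of forests with corners partitioned by `q` is a geometric expression in the number
of blocks, up to this factor. -/
def weight : Fin 5 → ℕ := ![1, 1, 1, 1, 3]

/-- The weighted number of ways to compose a forest of type `r` from three pieces. -/
def totalWeight : Fin 5 → ℕ := ![6, 10, 10, 10, 50]

/-- The weighted number of ways to compose a forest of type `r` from three pieces, of which the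
piece `i` has type `q`. -/
def pieceWeight (i : Fin 3) (q r : Fin 5) : ℕ :=
  ∑ s : Fin 3 → Fin 5, if Compat s r ∧ s i = q then ∏ k, weight (s k) else 0

theorem sum_fin_three_fun {M : Type} [AddCommMonoid M] (f : (Fin 3 → Fin 5) → M) :
    ∑ s, f s = ∑ a, ∑ b, ∑ c, f ![a, b, c] := by
  rw [← Fintype.sum_prod_type', ← Fintype.sum_prod_type']
  refine Fintype.sum_equiv
    ⟨fun s => ((s 0, s 1), s 2), fun x => ![x.1.1, x.1.2, x.2], fun s => ?_, fun x => rfl⟩ _ _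
    fun s => congrArg f ?_
  · ext i; fin_cases i <;> rfl
  · ext i; fin_cases i <;> rfl

theorem sum_weight (r : Fin 5) :
    ∑ s : Fin 3 → Fin 5, (if Compat s r then ∏ k, weight (s k) else 0) = totalWeight r := by
  rw [sum_fin_three_fun]
  revert r
  decide +kernel

theorem pieceWeight_zero (q r : Fin 5) : pieceWeight 0 q r =
    (![![4, 6, 6, 1, 12], ![1, 3, 1, 1, 7], ![1, 1, 3, 1, 7],
      ![0, 0, 0, 4, 12], ![0, 0, 0, 3, 12]] :
      Fin 5 → Fin 5 → ℕ) q r := by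
  rw [pieceWeight, sum_fin_three_fun]
  revert q r
  decide +kernel

theorem pieceWeight_one (q r : Fin 5) : pieceWeight 1 q r =
    (![![4, 6, 1, 6, 12], ![1, 3, 1, 1, 7], ![0, 0, 4, 0, 12],
      ![1, 1, 1, 3, 7], ![0, 0, 3, 0, 12]] :
      Fin 5 → Fin 5 → ℕ) q r := by
  rw [pieceWeight, sum_fin_three_fun]
  revert q r
  decide +kernel

theorem pieceWeight_two (q r : Fin 5) : pieceWeight 2 q r =
    (![![4, 1, 6, 6, 12], ![0, 4, 0, 0, 12], ![1, 1, 3, 1, 7],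
      ![1, 1, 1, 3, 7], ![0, 3, 0, 0, 12]] :
      Fin 5 → Fin 5 → ℕ) q r := by
  rw [pieceWeight, sum_fin_three_fun]
  revert q r
  decide +kernel

theorem patternForests_succ (n : ℕ) (r : Fin 5) : patternForests (n + 1) r =
    forests (glue (copy n) fun _ => SG n) (fun k => copy n k (corner n k)) r := by
  rw [patternForests, SG_succ, corner_succ]

theorem ncard_patternForests_succ (n : ℕ) (r : Fin 5) : (patternForests (n + 1) r).ncard =
    ∑ s : Fin 3 → Fin 5, if Compat s r then ∏ i, (patternForests n (s i)).ncard else 0 := by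
  have := (isGluing_copy n).ncard_forests_glue (SG n) (fun _ _ => True) r
  simp only [implies_true, and_true, Set.ofPred_mem_eq] at this
  rw [patternForests_succ, this]
  exact Finset.sum_congr rfl fun s _ => by congr

/-- Compatibility fixes the total number of blocks, so the geometric factor depends on `r` alone. -/
theorem prod_geometric {A ρ : ℚ} {s : Fin 3 → Fin 5} {r : Fin 5} (h : Compat s r) :
    ∏ k, (weight (s k) * A * ρ ^ blocks (s k)) =
      ((∏ k, weight (s k) : ℕ) : ℚ) * (A ^ 3 * ρ ^ 3 * ρ ^ blocks r) := by
  have hb : ρ ^ blocks r * ρ ^ 3 = ρ ^ blocks (s 0) * ρ ^ blocks (s 1) * ρ ^ blocks (s 2) := by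
    rw [← pow_add, ← h.2, pow_add, pow_add]
  simp only [Fin.prod_univ_three, Nat.cast_mul]
  linear_combination
    (-(weight (s 0) : ℚ) * weight (s 1) * weight (s 2) * A ^ 3) * hb

theorem ncard_patternForests_succ_of_geometric {n : ℕ} {A ρ : ℚ}
    (h : ∀ q, ((patternForests n q).ncard : ℚ) = weight q * A * ρ ^ blocks q) (r : Fin 5) :
    ((patternForests (n + 1) r).ncard : ℚ) =
      totalWeight r * (A ^ 3 * ρ ^ 3 * ρ ^ blocks r) := by
  rw [ncard_patternForests_succ, ← sum_weight]
  push_cast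
  rw [Finset.sum_mul]
  refine Finset.sum_congr rfl fun s _ => ?_
  by_cases hs : Compat s r
  · simp only [hs, if_true, h, prod_geometric hs]
    push_cast
    rfl
  · simp [hs]

theorem ncard_patternForests (n : ℕ) : ∃ A ρ : ℚ, 0 < A ∧ 0 < ρ ∧
    ∀ q, ((patternForests n q).ncard : ℚ) = weight q * A * ρ ^ blocks q := by
  induction n with
  | zero =>
    -- Solves `A * ρ = 3`, `A * ρ ^ 2 = 1`; then `3 * A * ρ ^ 3 = 1` holds as well.
    refine ⟨9, 1 / 3, by norm_num, by norm_num, fun q => ?_⟩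
    rw [ncard_patternForests_zero]
    fin_cases q <;> norm_num [weight, blocks]
  | succ n ih =>
    obtain ⟨A, ρ, hA, hρ, h⟩ := ih
    -- `5 / 3 = 10 / 6` is the ratio of the first two total weights, and `18 / 5 * 5 / 3 = 6`; the
    -- weight `3` of the last type makes `50` fit too.
    refine ⟨18 / 5 * (A ^ 3 * ρ ^ 3), 5 / 3 * ρ, by positivity, by positivity, fun q => ?_⟩
    rw [ncard_patternForests_succ_of_geometric h, mul_pow]
    have : (totalWeight q : ℚ) = weight q * (18 / 5) * (5 / 3) ^ blocks q := by
      fin_cases q <;> norm_num [totalWeight, weight, blocks]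
    rw [this]
    ring

/-- The matrix that carries the probabilities of a vertex inside `SG(n)` to those of its image in
the copy `i` of `SG(n)` in `SG(n + 1)`. -/
def transfer (i : Fin 3) : Matrix (Fin 5) (Fin 5) ℚ :=
  Matrix.of fun q r => (pieceWeight i q r : ℚ) / totalWeight r

/-- The probabilities that the vertex `x` has degree `j` in a forest of a given type. -/
noncomputable def probRow (j n : ℕ) (x : Vert n) : Fin 5 → ℚ :=
  fun r => degProb (patternForests n r) j x

theorem ncard_degree_copy (j n : ℕ) (i : Fin 3) {x : Vert n} (hx : ∀ k, x ≠ corner n k)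
    (r : Fin 5) :
    {T ∈ patternForests (n + 1) r | (T.neighborSet (copy n i x)).ncard = j}.ncard =
      ∑ s : Fin 3 → Fin 5, if Compat s r then
        ∏ k, {T ∈ patternForests n (s k) | k = i → (T.neighborSet x).ncard = j}.ncard else 0 := by
  have h := (isGluing_copy n).ncard_forests_glue (SG n)
    (fun k T => k = i → (T.neighborSet x).ncard = j) r
  rw [patternForests_succ]
  refine Eq.trans (congrArg Set.ncard ?_) (h.trans (Finset.sum_congr rfl fun s _ => by congr))
  ext T
  refine and_congr_right fun hT => ?_
  rw [forall_eq]
  have hT' := (isGluing_copy n).glue_comap hT.1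
  conv_lhs => rw [← hT', (isGluing_copy n).neighborSet_glue hx,
    Set.ncard_image_of_injective _ ((isGluing_copy n).injective i)]

/-- The degree condition concerns the piece `i` only, so it scales each composition by the
probability for the type of that piece. Grouping compositions by this type gives the matrix product.
-/
theorem probRow_copy (j n : ℕ) (i : Fin 3) {x : Vert n} (hx : ∀ k, x ≠ corner n k) :
    probRow j (n + 1) (copy n i x) = Matrix.vecMul (probRow j n x) (transfer i) := by
  obtain ⟨A, ρ, hA, hρ, hc⟩ := ncard_patternForests n
  have hw : ∀ q, (0 : ℚ) < weight q := by
    intro q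
    exact_mod_cast (show ∀ q, 0 < weight q by decide) q
  have hpos : ∀ q, ((patternForests n q).ncard : ℚ) ≠ 0 := fun q => by
    rw [hc]
    have := hw q
    positivity
  have hpiece : ∀ (s : Fin 3 → Fin 5),
      ∏ k, ({T ∈ patternForests n (s k) | k = i → (T.neighborSet x).ncard = j}.ncard : ℚ) =
        probRow j n x (s i) * ∏ k, ((patternForests n (s k)).ncard : ℚ) := by
    intro s
    rw [← Finset.mul_prod_erase _ _ (Finset.mem_univ i),
      ← Finset.mul_prod_erase _ (fun k => ((patternForests n (s k)).ncard : ℚ))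
        (Finset.mem_univ i), ← mul_assoc]
    congr 1
    · rw [probRow, degProb, div_mul_cancel₀ _ (hpos _)]
      simp
    · refine Finset.prod_congr rfl fun k hk => ?_
      simp [Finset.ne_of_mem_erase hk]
  have hnum : ∀ r, ({T ∈ patternForests (n + 1) r |
      (T.neighborSet (copy n i x)).ncard = j}.ncard : ℚ) =
        (∑ q, probRow j n x q * pieceWeight i q r) * (A ^ 3 * ρ ^ 3 * ρ ^ blocks r) := by
    intro r
    rw [ncard_degree_copy j n i hx]
    simp only [pieceWeight]
    push_cast
    simp_rw [Finset.mul_sum]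
    rw [Finset.sum_comm, Finset.sum_mul]
    refine Finset.sum_congr rfl fun s _ => ?_
    by_cases hs : Compat s r
    · simp only [hs, if_true, true_and, hpiece, hc, prod_geometric hs]
      push_cast
      simp [mul_assoc]
    · simp [hs]
  ext r
  have hne : A ^ 3 * ρ ^ 3 * ρ ^ blocks r ≠ 0 := by positivity
  rw [probRow, degProb, hnum, ncard_patternForests_succ_of_geometric hc,
    mul_div_mul_right _ _ hne, Finset.sum_div, Matrix.vecMul, dotProduct]
  refine Finset.sum_congr rfl fun q _ => ?_
  exact mul_div_assoc _ _ _

open Matrix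

/-! ### Matrix identities -/

/-- Exchange of the partitions `1` and `2`. -/
def swapOneTwo : Matrix (Fin 5) (Fin 5) ℚ :=
  !![1, 0, 0, 0, 0; 0, 0, 1, 0, 0; 0, 1, 0, 0, 0; 0, 0, 0, 1, 0; 0, 0, 0, 0, 1]

/-- Exchange of the partitions `2` and `3`. -/
def swapTwoThree : Matrix (Fin 5) (Fin 5) ℚ :=
  !![1, 0, 0, 0, 0; 0, 1, 0, 0, 0; 0, 0, 0, 1, 0; 0, 0, 1, 0, 0; 0, 0, 0, 0, 1]

/-- Exchange of the partitions `1` and `3`. -/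
def swapOneThree : Matrix (Fin 5) (Fin 5) ℚ :=
  !![1, 0, 0, 0, 0; 0, 0, 0, 1, 0; 0, 0, 1, 0, 0; 0, 1, 0, 0, 0; 0, 0, 0, 0, 1]

/-- The transfer matrix of the lower-left copy. -/
def lowerLeft : Matrix (Fin 5) (Fin 5) ℚ := swapTwoThree * matR * swapTwoThree

/-- The transfer matrix of the top copy. -/
def top : Matrix (Fin 5) (Fin 5) ℚ := swapOneTwo * matR * swapOneTwo

/-- The sum of the transfer matrices of the three copies. -/
def stepMat : Matrix (Fin 5) (Fin 5) ℚ := lowerLeft + matR + top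

theorem lowerLeft_eq : lowerLeft =
    !![2/3, 3/5,  3/5,  1/10, 6/25;
       1/6, 3/10, 1/10, 1/10, 7/50;
       1/6, 1/10, 3/10, 1/10, 7/50;
       0,   0,    0,    2/5,  6/25;
       0,   0,    0,    3/10, 6/25] := by
  simp [lowerLeft, swapTwoThree, matR]

theorem top_eq : top =
    !![2/3, 1/10, 3/5,  3/5,  6/25;
       0,   2/5,  0,    0,    6/25;
       1/6, 1/10, 3/10, 1/10, 7/50;
       1/6, 1/10, 1/10, 3/10, 7/50;
       0,   3/10, 0,    0,    6/25] := by
  simp [top, swapOneTwo, matR]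

theorem transfer_zero : transfer 0 = lowerLeft := by
  rw [lowerLeft_eq]
  ext q r
  change (pieceWeight 0 q r : ℚ) / totalWeight r = _
  rw [pieceWeight_zero]
  fin_cases q <;> fin_cases r <;> norm_num [totalWeight]

theorem transfer_one : transfer 1 = matR := by
  ext q r
  change (pieceWeight 1 q r : ℚ) / totalWeight r = _
  rw [pieceWeight_one]
  fin_cases q <;> fin_cases r <;> norm_num [totalWeight, matR]

theorem transfer_two : transfer 2 = top := by
  rw [top_eq]
  ext q r
  change (pieceWeight 2 q r : ℚ) / totalWeight r = _
  rw [pieceWeight_two]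
  fin_cases q <;> fin_cases r <;> norm_num [totalWeight]

theorem swapTwoThree_mul_self : swapTwoThree * swapTwoThree = 1 := by
  ext i j; fin_cases i <;> fin_cases j <;> simp [swapTwoThree]

theorem swapOneTwo_mul_self : swapOneTwo * swapOneTwo = 1 := by
  ext i j; fin_cases i <;> fin_cases j <;> simp [swapOneTwo]

theorem swapOneThree_mul_self : swapOneThree * swapOneThree = 1 := by
  ext i j; fin_cases i <;> fin_cases j <;> simp [swapOneThree]

/-- The reflection fixing the rightmost corner maps the right copy to itself. -/
theorem swapOneThree_mul_matR : swapOneThree * matR = matR * swapOneThree := by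
  simp [swapOneThree, matR]

theorem top_eq_conj : top = swapOneThree * lowerLeft * swapOneThree := by
  rw [top_eq, lowerLeft_eq]
  simp [swapOneThree]

/-- This is the origin of `matE`: on symmetric rows the left-hand swap in each conjugate of `matR`
disappears, and the right-hand factors add up to `matE`. -/
theorem matE_eq : matE = swapTwoThree + 1 + swapOneTwo := by
  ext i j
  fin_cases i <;> fin_cases j <;> norm_num [matE, swapTwoThree, swapOneTwo, one_apply]

theorem conj_pow_of_involution {R : Type} [Ring R] {s a : R} (hs : s * s = 1) (k : ℕ) :
    (s * a * s) ^ k = s * a ^ k * s := by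
  induction k with
  | zero => simp [hs]
  | succ k ih =>
    rw [pow_succ, ih, pow_succ]
    calc s * a ^ k * s * (s * a * s) = s * a ^ k * (s * s) * a * s := by noncomm_ring
      _ = s * (a ^ k * a) * s := by rw [hs]; noncomm_ring

theorem lowerLeft_mul_pow (k : ℕ) :
    lowerLeft * matR ^ k = swapTwoThree * (matR * lowerLeft ^ k * swapTwoThree) := by
  rw [lowerLeft, conj_pow_of_involution swapTwoThree_mul_self]
  calc _ = swapTwoThree * matR * swapTwoThree * matR ^ k * 1 := by noncomm_ring
    _ = _ := by rw [← swapTwoThree_mul_self]; noncomm_ring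

theorem top_mul_pow (k : ℕ) :
    top * matR ^ k = swapOneTwo * (matR * top ^ k * swapOneTwo) := by
  rw [top, conj_pow_of_involution swapOneTwo_mul_self]
  calc _ = swapOneTwo * matR * swapOneTwo * matR ^ k * 1 := by noncomm_ring
    _ = _ := by rw [← swapOneTwo_mul_self]; noncomm_ring

theorem matR_mul_top_pow (k : ℕ) :
    matR * top ^ k = swapOneThree * (matR * lowerLeft ^ k * swapOneThree) := by
  rw [top_eq_conj, conj_pow_of_involution swapOneThree_mul_self, mul_assoc, ← mul_assoc,
    ← swapOneThree_mul_matR]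
  noncomm_ring

/-- `matL` differs from `lowerLeft` in the fourth column. Both preserve the vectors whose last two
entries vanish and act on them in the same way, and `e1` is such a vector. -/
theorem lowerLeft_pow_mulVec (k : ℕ) : lowerLeft ^ k *ᵥ e1 = matL ^ k *ᵥ e1 := by
  suffices ∃ x y z, lowerLeft ^ k *ᵥ e1 = ![x, y, z, 0, 0] ∧ matL ^ k *ᵥ e1 = ![x, y, z, 0, 0] by
    obtain ⟨x, y, z, h1, h2⟩ := this
    rw [h1, h2]
  induction k with
  | zero => exact ⟨1, 0, 0, by simp [e1], by simp [e1]⟩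
  | succ k ih =>
    obtain ⟨x, y, z, h1, h2⟩ := ih
    simp only [pow_succ', ← mulVec_mulVec, h1, h2]
    refine ⟨2/3 * x + 3/5 * y + 3/5 * z, 1/6 * x + 3/10 * y + 1/10 * z,
      1/6 * x + 1/10 * y + 3/10 * z, ?_, ?_⟩
    · rw [lowerLeft_eq]
      ext i
      fin_cases i <;> simp [mulVec, dotProduct, Fin.sum_univ_five]
    · ext i
      fin_cases i <;> simp [matL, mulVec, dotProduct, Fin.sum_univ_five]

theorem swapTwoThree_mulVec : swapTwoThree *ᵥ e1 = e1 := by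
  ext i; fin_cases i <;> simp [swapTwoThree, e1]

theorem swapOneTwo_mulVec : swapOneTwo *ᵥ e1 = e1 := by
  ext i; fin_cases i <;> simp [swapOneTwo, e1]

theorem swapOneThree_mulVec : swapOneThree *ᵥ e1 = e1 := by
  ext i; fin_cases i <;> simp [swapOneThree, e1]

section Symmetric

variable {w : Fin 5 → ℚ}

theorem vecMul_swapTwoThree (h : w 2 = w 3) : w ᵥ* swapTwoThree = w := by
  ext i; fin_cases i <;> simp [swapTwoThree, vecMul, dotProduct, Fin.sum_univ_five, h]

theorem vecMul_swapOneTwo (h : w 1 = w 2) : w ᵥ* swapOneTwo = w := by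
  ext i; fin_cases i <;> simp [swapOneTwo, vecMul, dotProduct, Fin.sum_univ_five, h]

theorem vecMul_swapOneThree (h : w 1 = w 3) : w ᵥ* swapOneThree = w := by
  ext i; fin_cases i <;> simp [swapOneThree, vecMul, dotProduct, Fin.sum_univ_five, h]

theorem vecMul_stepMat_symm (h12 : w 1 = w 2) (h23 : w 2 = w 3) :
    (w ᵥ* stepMat) 1 = (w ᵥ* stepMat) 2 ∧ (w ᵥ* stepMat) 2 = (w ᵥ* stepMat) 3 := by
  rw [stepMat, lowerLeft_eq, top_eq]
  constructor <;> simp [matR, vecMul, dotProduct, Fin.sum_univ_five, h12, h23] <;> ring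

theorem vecMul_stepMat (h12 : w 1 = w 2) (h23 : w 2 = w 3) :
    w ᵥ* stepMat = w ᵥ* (matR * matE) := by
  rw [stepMat, vecMul_add, vecMul_add, lowerLeft, top, mul_assoc, mul_assoc, ← vecMul_vecMul,
    vecMul_swapTwoThree h23, ← vecMul_vecMul w swapOneTwo, vecMul_swapOneTwo h12, matE_eq,
    mul_add, mul_add, vecMul_add, vecMul_add, mul_one]

theorem vecMul_stepMat_pow (h12 : w 1 = w 2) (h23 : w 2 = w 3) (s : ℕ) :
    w ᵥ* stepMat ^ s = w ᵥ* (matR * matE) ^ s := by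
  induction s generalizing w with
  | zero => simp
  | succ s ih =>
    obtain ⟨h1, h2⟩ := vecMul_stepMat_symm h12 h23
    rw [pow_succ', pow_succ', ← vecMul_vecMul, ih h1 h2, vecMul_stepMat h12 h23, vecMul_vecMul]

/-- The entry `w A e₁`. -/
def entry (w : Fin 5 → ℚ) (A : Matrix (Fin 5) (Fin 5) ℚ) : ℚ := w ⬝ᵥ (A *ᵥ e1)

theorem entry_add (w : Fin 5 → ℚ) (A A' : Matrix (Fin 5) (Fin 5) ℚ) :
    entry w (A + A') = entry w A + entry w A' := by
  simp [entry, add_mulVec]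

theorem entry_mul (w : Fin 5 → ℚ) (A A' : Matrix (Fin 5) (Fin 5) ℚ) :
    entry w (A * A') = entry (w ᵥ* A) A' := by
  rw [entry, entry, ← mulVec_mulVec, dotProduct_mulVec]

theorem entry_mul_of_fixed (w : Fin 5 → ℚ) {A A' : Matrix (Fin 5) (Fin 5) ℚ}
    (h : A' *ᵥ e1 = e1) : entry w (A * A') = entry w A := by
  rw [entry, entry, ← mulVec_mulVec, h]

/-- Of the three choices for the first letter, one prolongs the run of `matR`. The other two are
carried by reflections, which fix `w` and `e1`, to `matR` followed by a run of `lowerLeft`. -/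
theorem entry_stepMat_mul_pow (h12 : w 1 = w 2) (h23 : w 2 = w 3) (k : ℕ) :
    entry w (stepMat * matR ^ k) =
      entry w (matR ^ (k + 1)) + 2 * entry w (matR * lowerLeft ^ k) := by
  have h1 : entry w (lowerLeft * matR ^ k) = entry w (matR * lowerLeft ^ k) := by
    rw [lowerLeft_mul_pow, entry_mul, vecMul_swapTwoThree h23,
      entry_mul_of_fixed _ swapTwoThree_mulVec]
  have h2 : entry w (top * matR ^ k) = entry w (matR * lowerLeft ^ k) := by
    rw [top_mul_pow, entry_mul, vecMul_swapOneTwo h12, entry_mul_of_fixed _ swapOneTwo_mulVec,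
      matR_mul_top_pow, entry_mul, vecMul_swapOneThree (h12.trans h23),
      entry_mul_of_fixed _ swapOneThree_mulVec]
  rw [stepMat, add_mul, add_mul, entry_add, entry_add, h1, h2, pow_succ']
  ring

/-- Induction with `w` replaced by `w ᵥ* stepMat`, which is symmetric again; the constant run left
over is treated by `entry_stepMat_mul_pow`. -/
theorem entry_stepMat_pow (h12 : w 1 = w 2) (h23 : w 2 = w 3) (k : ℕ) :
    entry w (stepMat ^ k) = entry w (matR ^ k) +
      2 * ∑ s ∈ Finset.range k, entry w (stepMat ^ s * (matR * lowerLeft ^ (k - 1 - s))) := by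
  induction k generalizing w with
  | zero => simp
  | succ k ih =>
    obtain ⟨h1, h2⟩ := vecMul_stepMat_symm h12 h23
    rw [pow_succ', entry_mul, ih h1 h2, Finset.sum_range_succ', ← entry_mul,
      entry_stepMat_mul_pow h12 h23]
    have : ∀ s ∈ Finset.range k,
        entry (w ᵥ* stepMat) (stepMat ^ s * (matR * lowerLeft ^ (k - 1 - s))) =
          entry w (stepMat ^ (s + 1) * (matR * lowerLeft ^ (k + 1 - 1 - (s + 1)))) := by
      intro s _
      rw [← entry_mul, ← mul_assoc, ← pow_succ', show k + 1 - 1 - (s + 1) = k - 1 - s by omega]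
    rw [Finset.sum_congr rfl this]
    simp
    ring

/-- A product of `k` transfer matrices that are not all equal is determined by its last run of
equal factors and by the factor before that run; by symmetry only two pairs of factors matter. -/
theorem entry_stepMat_pow_eq (h12 : w 1 = w 2) (h23 : w 2 = w 3) (k : ℕ) :
    entry w (stepMat ^ k) = entry w (matR ^ k) +
      2 * ∑ s ∈ Finset.range k, entry w (matR * (matE * matR) ^ s * matL ^ (k - 1 - s)) := by
  rw [entry_stepMat_pow h12 h23]
  congr 2
  refine Finset.sum_congr rfl fun s _ => ?_
  rw [entry_mul, vecMul_stepMat_pow h12 h23, ← entry_mul, ← mul_assoc, mul_pow_mul]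
  simp only [entry, ← mulVec_mulVec, lowerLeft_pow_mulVec]

end Symmetric

/-! ### The sum over all vertices -/

/-- The vertices of `SG(n)` other than its corners. -/
def interior (n : ℕ) : Finset (Vert n) := Finset.univ.filter fun x => ∀ k, x ≠ corner n k

theorem sum_interior_add_corners {n : ℕ} {M : Type} [AddCommMonoid M] (f : Vert n → M) :
    ∑ x, f x = ∑ x ∈ interior n, f x + ∑ k, f (corner n k) := by
  have hc : (interior n)ᶜ = Finset.univ.image (corner n) := by
    ext x
    simp [interior, eq_comm]
  rw [← Finset.sum_add_sum_compl (interior n), hc,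
    Finset.sum_image (corner_injective n).injOn]

/-- The reflected arguments in `B` stand for the two-tree types `2` and `3`, so its rows are full
probability rows. -/
theorem B_eq (j k : ℕ) (i : Fin 3) : B j k i = probRow j (k + 1) (lacunary k i) := by
  ext r
  simp only [B, of_apply, F, G, H, treeSet_eq, twoTreeSet_eq, threeTreeSet_eq, degProb_tilde,
    degProb_hat]
  fin_cases r <;> rfl

theorem sum_interior_succ (j n : ℕ) :
    ∑ x ∈ interior (n + 1), probRow j (n + 1) x =
      (∑ x ∈ interior n, probRow j n x) ᵥ* stepMat + ![1, 1, 1] ᵥ* B j n := by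
  have h1 := sum_interior_add_corners (probRow j (n + 1))
  -- Both decompositions end in the sum over the new corners, which cancels; the three shared
  -- vertices are the corners of the empty triangle.
  rw [(isGluing_copy n).sum_eq, corner_succ] at h1
  have h2 := add_right_cancel h1
  rw [← h2]
  congr 1
  · rw [stepMat, ← transfer_zero, ← transfer_one, ← transfer_two,
      ← Fin.sum_univ_three transfer, vecMul_sum]
    refine Finset.sum_congr rfl fun i _ => ?_
    rw [sum_vecMul]
    exact Finset.sum_congr rfl fun x hx => probRow_copy j n i (Finset.mem_filter.1 hx).2
  · obtain ⟨e0, e1, e2⟩ := lacunary_eq n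
    ext r
    simp only [vecMul, dotProduct, Fin.sum_univ_three, Pi.add_apply, ← e0, ← e1, ← e2, ← B_eq]
    simp

theorem tilde_lacunary (k : ℕ) (i : Fin 3) : tilde (lacunary k i) = lacunary k (![1, 0, 2] i) := by
  fin_cases i <;> rfl

theorem hat_lacunary (k : ℕ) (i : Fin 3) : hat (lacunary k i) = lacunary k (![2, 1, 0] i) := by
  rw [vert_ext_iff]
  fin_cases i <;> simp [hat, lacunary, pow_succ] <;> omega

theorem vecMul_B (j k : ℕ) (r : Fin 5) :
    (![1, 1, 1] ᵥ* B j k) r = ∑ i, degProb (patternForests (k + 1) r) j (lacunary k i) := by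
  simp only [vecMul, dotProduct, B_eq, probRow, Fin.sum_univ_three]
  simp

/-- The reflections permute the corners of the empty triangle, so summing over these corners removes
the difference between the two-tree types. -/
theorem vecMul_B_symm (j k : ℕ) : (![1, 1, 1] ᵥ* B j k) 1 = (![1, 1, 1] ᵥ* B j k) 2 ∧
    (![1, 1, 1] ᵥ* B j k) 2 = (![1, 1, 1] ᵥ* B j k) 3 := by
  have h2 : ∀ x, degProb (patternForests (k + 1) 2) j x =
      degProb (patternForests (k + 1) 1) j (tilde x) := fun x => (degProb_tilde _ j 1 x).symm
  have h3 : ∀ x, degProb (patternForests (k + 1) 3) j x =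
      degProb (patternForests (k + 1) 1) j (hat x) := fun x => (degProb_hat _ j 1 x).symm
  simp only [vecMul_B, h2, h3, tilde_lacunary, hat_lacunary, Fin.sum_univ_three]
  constructor <;> simp <;> ring

theorem sandwich_eq (M : Matrix (Fin 3) (Fin 5) ℚ) : sandwich M = ![1, 1, 1] ⬝ᵥ (M *ᵥ e1) := rfl

theorem sandwich_add (M M' : Matrix (Fin 3) (Fin 5) ℚ) :
    sandwich (M + M') = sandwich M + sandwich M' := by
  simp only [sandwich_eq, add_mulVec, dotProduct_add]

theorem sandwich_nsmul (k : ℕ) (M : Matrix (Fin 3) (Fin 5) ℚ) :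
    sandwich (k • M) = k * sandwich M := by
  rw [sandwich_eq, smul_mulVec, dotProduct_smul, nsmul_eq_mul, sandwich_eq]

theorem sandwich_sum {ι : Type} (s : Finset ι) (f : ι → Matrix (Fin 3) (Fin 5) ℚ) :
    sandwich (∑ i ∈ s, f i) = ∑ i ∈ s, sandwich (f i) := by
  simp only [sandwich_eq, sum_mulVec, dotProduct_sum]

theorem sandwich_mul (M : Matrix (Fin 3) (Fin 5) ℚ) (A : Matrix (Fin 5) (Fin 5) ℚ) :
    sandwich (M * A) = entry (![1, 1, 1] ᵥ* M) A := by
  rw [sandwich_eq, entry, ← mulVec_mulVec, dotProduct_mulVec]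

theorem sum_interior (j n : ℕ) : ∑ x ∈ interior n, probRow j n x =
    ![1, 1, 1] ᵥ* ∑ m ∈ Finset.Icc 1 n, B j (m - 1) * stepMat ^ (n - m) := by
  induction n with
  | zero =>
    have : interior 0 = ∅ := by
      refine Finset.filter_false_of_mem fun x _ h => ?_
      obtain ⟨k, rfl⟩ := corner_zero_surjective x
      exact h k rfl
    simp [this]
  | succ n ih =>
    rw [sum_interior_succ, ih, Finset.sum_Icc_succ_top (by omega), vecMul_vecMul, vecMul_add,
      Matrix.sum_mul]
    congr 2
    · refine Finset.sum_congr rfl fun m hm => ?_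
      rw [Finset.mem_Icc] at hm
      rw [Matrix.mul_assoc, ← pow_succ, show n + 1 - m = n - m + 1 by omega]
    · simp

theorem sum_F_corner (j n : ℕ) : ∑ k, F j n (corner n k) = 3 * F j n (o n) := by
  have h1 : F j n (corner n 2) = F j n (o n) := by
    rw [F, F, treeSet_eq]
    have := degProb_hat n j 0 (corner n 0)
    rwa [hat_corner] at this
  have h2 : F j n (corner n 1) = F j n (corner n 2) := by
    rw [F, F, treeSet_eq]
    have := degProb_tilde n j 0 (corner n 2)
    rwa [tilde_corner] at this
  rw [Fin.sum_univ_three, h2, h1, show corner n 0 = o n from rfl]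
  ring

theorem Phi_eq (j n : ℕ) : Phi j n =
    ∑ m ∈ Finset.Icc 1 n, sandwich (B j (m - 1) * stepMat ^ (n - m)) + 3 * F j n (o n) := by
  rw [Phi, sum_interior_add_corners, sum_F_corner, ← sandwich_sum]
  congr 1
  -- Coordinate `0` belongs to the spanning trees.
  have h := congrFun (sum_interior j n) 0
  rw [Finset.sum_apply] at h
  have hF : ∀ x, probRow j n x 0 = F j n x := fun x => by rw [F, treeSet_eq]; rfl
  simp only [hF] at h
  rw [h, sandwich_eq, dotProduct_mulVec]
  simp [e1, dotProduct, Fin.sum_univ_five]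

theorem sandwich_stepMat_pow (j m k : ℕ) : sandwich (B j m * stepMat ^ k) =
    sandwich (B j m * matR ^ k) +
      2 * ∑ s ∈ Finset.range k,
        sandwich (B j m * (matR * (matE * matR) ^ s * matL ^ (k - 1 - s))) := by
  obtain ⟨h12, h23⟩ := vecMul_B_symm j m
  simp only [sandwich_mul]
  exact entry_stepMat_pow_eq h12 h23 k

theorem Phi_eq_sum_range (j n : ℕ) : Phi j n =
    ∑ m ∈ Finset.Icc 1 n, sandwich (B j (m - 1) * matR ^ (n - m)) +
      2 * ∑ m ∈ Finset.Icc 1 n, ∑ s ∈ Finset.range (n - m),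
        sandwich (B j (m - 1) * (matR * (matE * matR) ^ s * matL ^ (n - m - 1 - s))) +
      3 * F j n (o n) := by
  rw [Phi_eq, Finset.mul_sum, ← Finset.sum_add_distrib]
  congr 1
  exact Finset.sum_congr rfl fun m _ => sandwich_stepMat_pow j (m - 1) (n - m)

end SierpinskiGasket

open SierpinskiGasket
/-- In the sums below `B j (m - 1)` is the matrix `B_j(m, m - 1)`, where `m ≥ 1`. -/
theorem mainTheorem5 (n : ℕ) (hn : 3 ≤ n) (j : ℕ) (hj1 : 1 ≤ j) (hj4 : j ≤ 4) :
    Phi j n =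
        sandwich (∑ m ∈ Finset.Icc 1 n, B j (m - 1) * matR ^ (n - m)
          + 2 • ∑ m ∈ Finset.Icc 1 (n - 1), B j (m - 1) * matR * matL ^ (n - m - 1)
          + 2 • ∑ m ∈ Finset.Icc 1 (n - 2), B j (m - 1) *
              ∑ s ∈ Finset.Icc 1 (n - m - 1), matR * (matE * matR) ^ s * matL ^ (n - 1 - m - s))
        + 3 * F j n (o n) ∧
    Phi j n =
        sandwich (∑ m ∈ Finset.Icc 1 n, B j (m - 1) * matR ^ (n - m)
          + 2 • (B j (n - 2) * matR)
          + 2 • ∑ m ∈ Finset.Icc 1 (n - 2), B j (m - 1) *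
              ∑ s ∈ Finset.Icc 0 (n - m - 1), matR * (matE * matR) ^ s * matL ^ (n - m - 1 - s))
        + 3 * F j n (o n) := by
  obtain ⟨N, rfl⟩ : ∃ N, n = N + 2 := ⟨n - 2, by omega⟩
  have hsum : Phi j (N + 2) =
      ∑ m ∈ Finset.Icc 1 (N + 2), sandwich (B j (m - 1) * matR ^ (N + 2 - m)) +
      2 * sandwich (B j N * matR) +
      2 * ∑ m ∈ Finset.Icc 1 N, ∑ s ∈ Finset.Icc 0 (N + 2 - m - 1),
        sandwich (B j (m - 1) * (matR * (matE * matR) ^ s * matL ^ (N + 2 - m - 1 - s))) +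
      3 * F j (N + 2) (o (N + 2)) := by
    have hrange : ∀ m ∈ Finset.Icc 1 N,
        Finset.range (N + 2 - m) = Finset.Icc 0 (N + 2 - m - 1) := by
      intro m hm
      rw [Finset.mem_Icc] at hm
      ext s
      simp only [Finset.mem_range, Finset.mem_Icc]
      omega
    rw [Phi_eq_sum_range]
    congr 1
    rw [add_assoc, ← mul_add]
    congr 2
    -- The term `m = N + 2` has an empty inner sum, whereas truncated subtraction would make the
    -- interval `{0}`; so it is split off before passing to `Icc`. The term `m = N + 1` consists of
    -- `s = 0` alone.
    rw [Finset.sum_Icc_succ_top (by omega : 1 ≤ N + 1 + 1), Finset.sum_Icc_succ_top (by omega),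
      Finset.sum_congr rfl fun m hm => Finset.sum_congr (hrange m hm) fun _ _ => rfl]
    rw [show N + 2 - (N + 1) = 1 by omega, show N + 2 - (N + 1 + 1) = 0 by omega]
    simp [add_comm]
  have hsplit : sandwich (B j N * matR) + ∑ m ∈ Finset.Icc 1 N,
      ∑ s ∈ Finset.Icc 0 (N + 2 - m - 1),
        sandwich (B j (m - 1) * (matR * (matE * matR) ^ s * matL ^ (N + 2 - m - 1 - s))) =
      ∑ m ∈ Finset.Icc 1 (N + 1), sandwich (B j (m - 1) * matR * matL ^ (N + 2 - m - 1)) +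
      ∑ m ∈ Finset.Icc 1 N, ∑ s ∈ Finset.Icc 1 (N + 2 - m - 1),
        sandwich (B j (m - 1) * (matR * (matE * matR) ^ s * matL ^ (N + 1 - m - s))) := by
    -- The terms with `s = 0`, together with the isolated term `m = N + 1`, where the power of
    -- `matL` is trivial, make up the middle sum of the first formula.
    rw [Finset.sum_Icc_succ_top (by omega), add_right_comm, ← Finset.sum_add_distrib, add_comm]
    congr 1
    · refine Finset.sum_congr rfl fun m _ => ?_
      rw [show N + 2 - m - 1 = N + 1 - m by omega,
        ← Finset.insert_Icc_add_one_left_eq_Icc (Nat.zero_le (N + 1 - m)),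
        Finset.sum_insert (by simp)]
      simp [Matrix.mul_assoc]
    · simp [show N + 2 - (N + 1) = 1 by omega]
  simp only [sandwich_add, sandwich_nsmul, sandwich_sum, Matrix.mul_sum, Nat.cast_ofNat,
    Nat.add_sub_cancel, show N + 2 - 1 = N + 1 by omega]
  refine ⟨?_, hsum⟩
  rw [hsum]
  linear_combination 2 * hsplit
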